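/- Let $\mathbb K$ be a field of characteristic $0$, $V$ a $\mathbb K$-vector space with basis $v_1,\dots,v_n$, and $G$ an abelian group acting linearly and diagonally on $V$: ${}^g v_i=\chi_i(g)\,v_i$ with characters $\chi_i:G\to\mathbb K^*$. Let $\mathbf q=\{q_{ij}\}$ be nonzero scalars with $q_{ii}=1$ and $q_{ji}=q_{ij}^{-1}$, and let $\kappa:V\times V\to V\otimes\mathbb KG$ be bilinear with $\kappa(v_i,v_j)=-q_{ij}\,\kappa(v_j,v_i)$ for all $i,j$. Write $$\kappa(v_i,v_j)=\sum_{g\in G}\kappa_g(v_i,v_j)\otimes g=\sum_{r,g}c_r^{ijg}\,v_r\otimes g\qquad(\kappa_g(v_i,v_j)\in V,\ c_r^{ijg}\in\mathbb K).$$ Let $T(V)\rtimes G$ be the skew group algebra of the tensor algebra, with multiplication $(r\,g)(s\,h)=r\,({}^g s)\,gh$, identify $v\otimes g$ with $v\,g$ in it, and put $$\mathcal H_{\mathbf q,\kappa}=(T(V)\rtimes G)/\big(v_iv_j-q_{ij}v_jv_i-\kappa(v_i,v_j):1\le i,j\le n\big).$$ We say that $\mathcal H_{\mathbf q,\kappa}$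 has the PBW property if the images of the monomials $v_1^{m_1}\cdots v_n^{m_n}g$, indexed by the pairs $(m,g)\in\mathbb N^n\times G$, form a $\mathbb K$-basis of $\mathcal H_{\mathbf q,\kappa}$. **Theorem.** $\mathcal H_{\mathbf q,\kappa}$ has the PBW property if and only if the following three conditions hold. 1. $\kappa$ is $G$-invariant: $\kappa({}^gv,{}^gw)={}^g\kappa(v,w)$ for all $g\in G$ and $v,w\in V$, where ${}^g(v\otimes h)={}^gv\otimes ghg^{-1}$. 2. For all $g\in G$ and all distinct $i,j,k$, $$0=\big(\chi_k(g)-q_{jk}q_{ik}q_{kr}\big)\,c_r^{ijg}\quad\text{for every } r\ne i,j,$$ $$0=\big(1-q_{ij}\chi_i(g)\big)\,c_k^{jkg}+\big(q_{jk}-\chi_k(g)\big)\,c_i^{ijg}.$$ 3. For all distinct $i,j,k$, in $V\otimes\mathbb KG$, $$0=\sum_{g\in G}\Big(\sum_{\circlearrowleft}\big(\chi_k(g)-q_{jk}\big)\,c_i^{ijg}\,\kappa(v_k,v_i)+\sum_{\circlearrowleft}q_{jk}\,\kappa\big(v_k,\kappa_g(v_i,v_j)\big)\Big)\,g,$$ where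 $\sum_{\circlearrowleft}$ is the sum over the cyclic permutations of $(i,j,k)$ and $(v\otimes h)\,g=v\otimes hg$. -/

import Mathlib

open scoped TensorProduct

namespace QuantumDrinfeld

noncomputable section

section Action

variable {K G V : Type*} [Field K] [Group G] [AddCommGroup V] [Module K V]
  [DistribMulAction G V] [SMulCommClass G K V]

/-- A linear action of `G` on `V` extends to an action of `G` on the tensor algebra `T(V)`
by algebra automorphisms. -/
instance tensorAlgebraAction : MulSemiringAction G (TensorAlgebra K V) where
  smul g := TensorAlgebra.lift K
    ((TensorAlgebra.ι K).comp (DistribSMul.toLinearMap K V g))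
  one_smul a := by
    change TensorAlgebra.lift K _ a = a
    have : TensorAlgebra.lift K
        ((TensorAlgebra.ι K).comp (DistribSMul.toLinearMap K V (1 : G))) =
        AlgHom.id K (TensorAlgebra K V) := by
      ext x; simp
    rw [this]; rfl
  mul_smul g h a := by
    change TensorAlgebra.lift K _ a = TensorAlgebra.lift K _ (TensorAlgebra.lift K _ a)
    rw [← AlgHom.comp_apply]
    congr 1
    ext x; simp [mul_smul]
  smul_zero g := map_zero (TensorAlgebra.lift K _)
  smul_add g := map_add (TensorAlgebra.lift K _)
  smul_one g := map_one (TensorAlgebra.lift K _)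
  smul_mul g := map_mul (TensorAlgebra.lift K _)

theorem smul_tensorAlgebra_def (g : G) (a : TensorAlgebra K V) :
    g • a = TensorAlgebra.lift K
      ((TensorAlgebra.ι K).comp (DistribSMul.toLinearMap K V g)) a := rfl

@[simp]
theorem smul_ι (g : G) (x : V) :
    g • (TensorAlgebra.ι K x) = TensorAlgebra.ι K (g • x) := by
  simp [smul_tensorAlgebra_def]

instance tensorAlgebra_smulCommClass : SMulCommClass G K (TensorAlgebra K V) where
  smul_comm g c a := by simp [smul_tensorAlgebra_def]

end Action

section Algebra

variable (K G V : Type*) [Field K] [Group G] [AddCommGroup V] [Module K V]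
  [DistribMulAction G V] [SMulCommClass G K V]

/-- The skew group algebra `T(V) ⋊ G`, with multiplication `(r g) (s h) = r (ᵍs) (gh)`. The
element `r g` is `SkewMonoidAlgebra.single g r`. -/
abbrev SkewGroupAlgebra : Type _ := SkewMonoidAlgebra (TensorAlgebra K V) G

/-- The inclusion `V → T(V) ⋊ G`. -/
def vec : V →ₗ[K] SkewGroupAlgebra K G V :=
  (SkewMonoidAlgebra.lsingle K (1 : G)).comp (TensorAlgebra.ι K)

/-- The inclusion `G → T(V) ⋊ G`. -/
def grp : G →* SkewGroupAlgebra K G V :=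
  SkewMonoidAlgebra.of (TensorAlgebra K V) G

/-- The linear map `V ⊗ KG → T(V) ⋊ G`, `v ⊗ g ↦ v g`. -/
def vecGrp : V ⊗[K] MonoidAlgebra K G →ₗ[K] SkewGroupAlgebra K G V :=
  (LinearMap.mul' K (SkewGroupAlgebra K G V)).comp
    (TensorProduct.map (vec K G V)
      (MonoidAlgebra.lift K (SkewGroupAlgebra K G V) G (grp K G V)).toLinearMap)

open scoped Classical in
/-- The `G`-component map: the element `∑ w_g ⊗ g` of `V ⊗ KG` goes to the finitely supported
function `g ↦ w_g`. -/
def components : V ⊗[K] MonoidAlgebra K G ≃ₗ[K] (G →₀ V) :=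
  (TensorProduct.congr (LinearEquiv.refl K V) (MonoidAlgebra.coeffLinearEquiv K)).trans
    (TensorProduct.finsuppScalarRight K K V G)

variable {K G V}

/-- Right multiplication by `g` on `V ⊗ KG`: `(v ⊗ h) g = v ⊗ hg`. -/
def mulGrp (g : G) : V ⊗[K] MonoidAlgebra K G →ₗ[K] V ⊗[K] MonoidAlgebra K G :=
  LinearMap.lTensor V (LinearMap.mulRight K (MonoidAlgebra.single g (1 : K)))

/-- The adjoint action of `G` on `V ⊗ KG`: `ᵍ(v ⊗ h) = ᵍv ⊗ g h g⁻¹`. -/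
def adjointAction (g : G) : V ⊗[K] MonoidAlgebra K G →ₗ[K] V ⊗[K] MonoidAlgebra K G :=
  TensorProduct.map (DistribSMul.toLinearMap K V g)
    (MonoidAlgebra.domCongr K K (MulAut.conj g)).toLinearMap

/-- A bilinear `κ : V × V → V ⊗ KG` is `G`-invariant if `κ(ᵍv, ᵍw) = ᵍ(κ(v, w))` for the
adjoint action on `V ⊗ KG`. -/
def IsInvariant (κ : V →ₗ[K] V →ₗ[K] V ⊗[K] MonoidAlgebra K G) : Prop :=
  ∀ (g : G) (x y : V), κ (g • x) (g • y) = adjointAction g (κ x y)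

/-- A quantum system of parameters. -/
structure IsQuantumSystem {n : ℕ} (q : Fin n → Fin n → K) : Prop where
  ne_zero : ∀ i j, q i j ≠ 0
  diag : ∀ i, q i i = 1
  symm : ∀ i j, q j i = (q i j)⁻¹

/-- Quantum antisymmetry of `κ`: `κ(v_i, v_j) = - q_ij κ(v_j, v_i)`. -/
def IsQuantumAntisymm {n : ℕ} (v : Module.Basis (Fin n) K V) (q : Fin n → Fin n → K)
    (κ : V →ₗ[K] V →ₗ[K] V ⊗[K] MonoidAlgebra K G) : Prop :=
  ∀ i j, κ (v i) (v j) = -(q i j • κ (v j) (v i))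

/-- `κ_g(x, y)`, where `κ(x, y) = ∑ κ_g(x, y) ⊗ g`. -/
def comp (κ : V →ₗ[K] V →ₗ[K] V ⊗[K] MonoidAlgebra K G) (g : G) (x y : V) : V :=
  components K G V (κ x y) g

/-- The coefficient `c_r^{ijg}` of `v_r ⊗ g` in `κ(v_i, v_j)`. -/
def coef {n : ℕ} (v : Module.Basis (Fin n) K V)
    (κ : V →ₗ[K] V →ₗ[K] V ⊗[K] MonoidAlgebra K G) (r i j : Fin n) (g : G) : K :=
  v.repr (comp κ g (v i) (v j)) r

/-- The defining relations `v_i v_j - q_ij v_j v_i - κ(v_i, v_j) = 0`, for all `i, j`. -/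
inductive Rel {n : ℕ} (v : Module.Basis (Fin n) K V) (q : Fin n → Fin n → K)
    (κ : V →ₗ[K] V →ₗ[K] V ⊗[K] MonoidAlgebra K G) :
    SkewGroupAlgebra K G V → SkewGroupAlgebra K G V → Prop
  | commutator (i j : Fin n) : Rel v q κ
      (vec K G V (v i) * vec K G V (v j) - q i j • (vec K G V (v j) * vec K G V (v i))
        - vecGrp K G V (κ (v i) (v j))) 0

/-- The algebra `H_{q,κ}`, the quotient of `T(V) ⋊ G` by the two-sided ideal generated by the
elements `v_i v_j - q_ij v_j v_i - κ(v_i, v_j)`. -/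
abbrev QuotientAlgebra {n : ℕ} (v : Module.Basis (Fin n) K V) (q : Fin n → Fin n → K)
    (κ : V →ₗ[K] V →ₗ[K] V ⊗[K] MonoidAlgebra K G) : Type _ :=
  RingQuot (Rel v q κ)

/-- The element `v_1^{m_1} v_2^{m_2} ⋯ v_n^{m_n} g` of `T(V) ⋊ G`. -/
def monomial {n : ℕ} (v : Module.Basis (Fin n) K V) (p : (Fin n → ℕ) × G) :
    SkewGroupAlgebra K G V :=
  (List.ofFn fun i : Fin n => vec K G V (v i) ^ p.1 i).prod * grp K G V p.2

/-- The image of `v_1^{m_1} v_2^{m_2} ⋯ v_n^{m_n} g` in `H_{q,κ}`. -/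
def pbwMonomial {n : ℕ} (v : Module.Basis (Fin n) K V) (q : Fin n → Fin n → K)
    (κ : V →ₗ[K] V →ₗ[K] V ⊗[K] MonoidAlgebra K G) (p : (Fin n → ℕ) × G) :
    QuotientAlgebra v q κ :=
  RingQuot.mkAlgHom K (Rel v q κ) (monomial v p)

/-- The PBW property: the images of the monomials `v_1^{m_1} ⋯ v_n^{m_n} g`, indexed by the
pairs `(m, g)`, form a `K`-basis of `H_{q,κ}`. -/
def HasPBW {n : ℕ} (v : Module.Basis (Fin n) K V) (q : Fin n → Fin n → K)
    (κ : V →ₗ[K] V →ₗ[K] V ⊗[K] MonoidAlgebra K G) : Prop :=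
  LinearIndependent K (pbwMonomial v q κ) ∧
    Submodule.span K (Set.range (pbwMonomial v q κ)) = ⊤

/-- The `(i, j, k)`-summand of the Jacobi-type sum, an element of `V ⊗ KG`:
`∑_g ((χ_k(g) - q_jk) c_i^{ijg} κ(v_k, v_i) + q_jk κ(v_k, κ_g(v_i, v_j))) g`.
The bound variable `w` is `κ_g(v_i, v_j)`, so that `v.repr w i` is `c_i^{ijg}`; the sum runs over
the finitely many `g` with `w ≠ 0`. -/
def jacobiSummand {n : ℕ} (v : Module.Basis (Fin n) K V) (χ : Fin n → G →* Kˣ)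
    (q : Fin n → Fin n → K) (κ : V →ₗ[K] V →ₗ[K] V ⊗[K] MonoidAlgebra K G)
    (i j k : Fin n) : V ⊗[K] MonoidAlgebra K G :=
  (components K G V (κ (v i) (v j))).sum fun g w =>
    mulGrp g ((((χ k g : K) - q j k) * v.repr w i) • κ (v k) (v i) + q j k • κ (v k) w)

end Algebra

end

end QuantumDrinfeld

/-! ### A linear diamond lemma -/

/-! The relations are read as rewriting rules v_a v_b → q_ab v_b v_a + κ(v_a, v_b) for b < a, acting
on the basis of `T(V) ⋊ G` formed by words times group elements. In shortlex order each rule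
replaces a word by smaller ones, and the irreducible words are the weakly increasing ones. Hence the
PBW monomials always span (`span_pbwMonomial`), and the theorem is about their independence.

Both directions rest on `quantum_jacobi`: a q-weighted cyclic sum of relators times a third basis
vector has no cubic part, so only products of some κ(v_i, v_j) with v_k remain. Condition 2 makes
the quadratic part of this remainder vanish modulo relators, and what is left is minus the
expression of condition 3 (`jacobi_sum_mem`).

If the three conditions hold, a linear form of Bergman's diamond lemma applies. Invariance lets
group elements pass through relators, which settles disjoint ambiguities and makes the span of the
relations a two-sided ideal. The Jacobi identity settles the overlaps v_i v_j v_k with k < j < i.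
The ideal then meets the span of the PBW monomials trivially.

Conversely, a PBW basis permits comparison of coefficients in the quotient, where all relators
vanish. Computing g v_i v_j in two ways gives invariance; the quadratic coordinates of the Jacobi
sum give condition 2; its linear remainder gives condition 3, because V ⊗ KG embeds
(`vecGrp_injective`).

Stating the computations for a `CovariantPair` makes them available both in `T(V) ⋊ G` and in its
quotient. -/

namespace LinearRewriting

open Module Submodule

variable {R A X : Type*} [CommRing R] [AddCommGroup A] [Module R A]
  (b : Basis X R A) (r : X → X → Prop) (P : X → A → Prop)

/-- The span of the basis vectors that are strictly smaller than `x`. -/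
def lowerSpan (x : X) : Submodule R A := span R (b '' {y | r y x})

/-- The span of the relations with leading index strictly smaller than `x`. -/
def lowerRelations (x : X) : Submodule R A := span R {e | ∃ y, r y x ∧ P y e}

/-- The span of all relations. -/
def relations : Submodule R A := span R {e | ∃ y, P y e}

/-- The span of the basis vectors that do not lead a relation. -/
def normalSpan : Submodule R A := span R (b '' {x | ∀ e, ¬ P x e})

variable {b r P}

/-- Well-founded induction on b x = e + (b x - e). Only termination matters here; confluence plays
no role. -/
theorem relations_sup_normalSpan (hr : WellFounded r)
    (hP : ∀ x e, P x e → b x - e ∈ lowerSpan b r x) :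
    relations (R := R) P ⊔ normalSpan b P = ⊤ := by
  have key : ∀ x, b x ∈ relations (R := R) P ⊔ normalSpan b P := by
    intro x
    induction x using hr.induction with
    | _ x ih =>
      by_cases h : ∃ e, P x e
      · obtain ⟨e, he⟩ := h
        have h1 : lowerSpan b r x ≤ relations (R := R) P ⊔ normalSpan b P := by
          refine span_le.2 ?_
          rintro _ ⟨y, hy, rfl⟩
          exact ih y hy
        have h2 : e ∈ relations (R := R) P ⊔ normalSpan b P :=
          mem_sup_left (subset_span ⟨x, he⟩)
        simpa using add_mem (h1 (hP x e he)) h2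
      · exact mem_sup_right (subset_span ⟨x, fun e he => h ⟨e, he⟩, rfl⟩)
  rw [eq_top_iff, ← b.span_eq]
  refine span_le.2 ?_
  rintro _ ⟨x, rfl⟩
  exact key x

open scoped Classical in
/-- A normal form map, which rewrites a reducible basis vector by a chosen relation. -/
noncomputable def normalForm (b : Basis X R A) (r : X → X → Prop) (P : X → A → Prop)
    (hr : WellFounded r) : X → A :=
  hr.fix fun x ih =>
    if h : ∃ e, P x e then
      -- When b x - e lies in the lower span, every y in the support satisfies r y x, so the default
      -- 0 is never taken.
      (b.repr (b x - h.choose)).sum fun y c => if hy : r y x then c • ih y hy else 0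
    else b x

theorem normalForm_of_irreducible (hr : WellFounded r) {x : X} (hx : ∀ e, ¬ P x e) :
    normalForm b r P hr x = b x := by
  rw [normalForm, hr.fix_eq, dif_neg]
  rintro ⟨e, he⟩
  exact hx e he

/-- The recursion itself kills the one relation chosen at x; the other relations at x require
confluence. -/
theorem exists_constr_normalForm (hr : WellFounded r)
    (hP : ∀ x e, P x e → b x - e ∈ lowerSpan b r x) {x : X} {e : A} (he : P x e) :
    ∃ e', P x e' ∧ b.constr R (normalForm b r P hr) e' = 0 := by
  classical
  have h : ∃ e, P x e := ⟨e, he⟩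
  refine ⟨h.choose, h.choose_spec, ?_⟩
  have h1 : normalForm b r P hr x = b.constr R (normalForm b r P hr) (b x - h.choose) := by
    conv_lhs => rw [normalForm, hr.fix_eq, dif_pos h]
    rw [Basis.constr_apply]
    refine Finsupp.sum_congr fun y hy => ?_
    have h2 := (b.mem_span_image).1 (hP x _ h.choose_spec)
    have h3 : r y x := h2 hy
    rw [dif_pos h3]
    rfl
  rw [map_sub, Basis.constr_basis] at h1
  simpa using h1.symm

/-- If all ambiguities are resolvable relative to the order, then the normal form map kills all
relations. -/
theorem constr_normalForm_eq_zero (hr : WellFounded r)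
    (hP : ∀ x e, P x e → b x - e ∈ lowerSpan b r x)
    (hc : ∀ x e e', P x e → P x e' → e - e' ∈ lowerRelations (R := R) r P x) (x : X) :
    ∀ e, P x e → b.constr R (normalForm b r P hr) e = 0 := by
  induction x using hr.induction with
  | _ x ih =>
    intro e he
    obtain ⟨e', he', h0⟩ := exists_constr_normalForm hr hP he
    have h1 : lowerRelations (R := R) r P x ≤
        LinearMap.ker (b.constr R (normalForm b r P hr)) := by
      refine span_le.2 ?_
      rintro e ⟨y, hy, h⟩
      exact ih y hy e h
    -- An arbitrary relation differs from the chosen one by relations with smaller leading index,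
    -- which are already killed by induction.
    have h2 := h1 (hc x e e' he he')
    rw [LinearMap.mem_ker, map_sub, h0, sub_zero] at h2
    exact h2

/-- The normal form map is the identity on the first subspace and zero on the second. -/
theorem disjoint_normalSpan_relations (hr : WellFounded r)
    (hP : ∀ x e, P x e → b x - e ∈ lowerSpan b r x)
    (hc : ∀ x e e', P x e → P x e' → e - e' ∈ lowerRelations (R := R) r P x) :
    Disjoint (normalSpan b P) (relations (R := R) P) := by
  rw [Submodule.disjoint_def]
  intro z hz hz'
  have h1 : relations (R := R) P ≤ LinearMap.ker (b.constr R (normalForm b r P hr)) := by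
    refine span_le.2 ?_
    rintro e ⟨y, h⟩
    exact constr_normalForm_eq_zero hr hP hc y e h
  have h2 : normalSpan b P ≤
      LinearMap.eqLocus (b.constr R (normalForm b r P hr)) LinearMap.id := by
    refine span_le.2 ?_
    rintro _ ⟨x, hx, rfl⟩
    simp [normalForm_of_irreducible hr hx]
  have h3 := h2 hz
  have h4 := h1 hz'
  simp only [LinearMap.mem_eqLocus, LinearMap.id_apply] at h3
  rw [← h3]
  exact h4

end LinearRewriting

namespace QuantumDrinfeld

noncomputable section

/-! ### Group components of V ⊗ KG -/

section TensorGroupAlgebra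

variable {K G V : Type*} [Field K] [AddCommGroup V] [Module K V]

theorem tmul_single_induction [Monoid G] {p : V ⊗[K] MonoidAlgebra K G → Prop} (h0 : p 0)
    (hadd : ∀ y z, p y → p z → p (y + z))
    (hs : ∀ (x : V) (g : G), p (x ⊗ₜ MonoidAlgebra.single g 1)) (y : V ⊗[K] MonoidAlgebra K G) :
    p y := by
  induction y using TensorProduct.induction_on with
  | zero => exact h0
  | add y z hy hz => exact hadd y z hy hz
  | tmul x a =>
    induction a using MonoidAlgebra.induction_linear with
    | zero => simpa using h0
    | add a b ha hb => rw [TensorProduct.tmul_add]; exact hadd _ _ ha hb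
    | single g c =>
      have : (MonoidAlgebra.single g c : MonoidAlgebra K G) = c • MonoidAlgebra.single g 1 := by
        simp
      rw [this, ← TensorProduct.smul_tmul]
      exact hs _ _

@[simp]
theorem components_tmul_single (x : V) (g : G) :
    components K G V (x ⊗ₜ MonoidAlgebra.single g 1) = Finsupp.single g x := by
  classical
  ext h
  simp [components, TensorProduct.finsuppScalarRight_apply_tmul_apply, Finsupp.single_apply]

end TensorGroupAlgebra

section WordChar

variable {G M : Type*} [Monoid G] [CommGroup M] {n : ℕ}

/-- The character through which `G` acts on a word. -/
def wordChar (χ : Fin n → G →* M) (w : List (Fin n)) : G →* M := (w.map χ).prod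

@[simp]
theorem wordChar_nil (χ : Fin n → G →* M) : wordChar χ [] = 1 := rfl

@[simp]
theorem wordChar_cons (χ : Fin n → G →* M) (i : Fin n) (w : List (Fin n)) :
    wordChar χ (i :: w) = χ i * wordChar χ w := rfl

end WordChar

/-! ### Covariant pairs -/

variable {K G V : Type*} [Field K] [CommGroup G] [AddCommGroup V] [Module K V]
  [DistribMulAction G V]

variable (K G V) in
/-- A pair of maps from `V` and `G` to an algebra that is covariant for the action of `G` on `V`:
the data of an algebra map from `T(V) ⋊ G`. -/
structure CovariantPair (A : Type*) [Ring A] [Algebra K A] where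
  /-- The map on `V`. -/
  vec : V →ₗ[K] A
  /-- The map on `G`. -/
  grp : G →* A
  grp_mul_vec : ∀ g x, grp g * vec x = vec (g • x) * grp g

namespace CovariantPair

variable [SMulCommClass G K V] {n : ℕ} {A : Type*} [Ring A] [Algebra K A]
  (ρ : CovariantPair K G V A) (v : Module.Basis (Fin n) K V)

/-- The linear map `v ⊗ g ↦ v g`. -/
def vecGrp : V ⊗[K] MonoidAlgebra K G →ₗ[K] A :=
  (LinearMap.mul' K A).comp
    (TensorProduct.map ρ.vec (MonoidAlgebra.lift K A G ρ.grp).toLinearMap)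

/-- The product of the basis vectors spelled by a word. -/
def wordProd (w : List (Fin n)) : A := (w.map fun i => ρ.vec (v i)).prod

omit [SMulCommClass G K V] in
@[simp]
theorem wordProd_nil : ρ.wordProd v [] = 1 := rfl

omit [SMulCommClass G K V] in
@[simp]
theorem wordProd_cons (i : Fin n) (w : List (Fin n)) :
    ρ.wordProd v (i :: w) = ρ.vec (v i) * ρ.wordProd v w := by
  simp [wordProd]

omit [SMulCommClass G K V] in
@[simp]
theorem wordProd_append (u w : List (Fin n)) :
    ρ.wordProd v (u ++ w) = ρ.wordProd v u * ρ.wordProd v w := by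
  simp [wordProd]

omit [SMulCommClass G K V] in
@[simp]
theorem vecGrp_tmul_single (x : V) (g : G) :
    ρ.vecGrp (x ⊗ₜ MonoidAlgebra.single g 1) = ρ.vec x * ρ.grp g := by
  simp [vecGrp]

omit [SMulCommClass G K V] in
theorem vecGrp_eq_sum (y : V ⊗[K] MonoidAlgebra K G) :
    ρ.vecGrp y = (components K G V y).sum fun g w => ρ.vec w * ρ.grp g := by
  classical
  induction y using tmul_single_induction with
  | h0 => simp
  | hadd y z hy hz =>
    rw [map_add, hy, hz, map_add, Finsupp.sum_add_index'] <;> simp [add_mul]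
  | hs x g => simp

omit [SMulCommClass G K V] in
theorem vecGrp_mulGrp (g : G) (y : V ⊗[K] MonoidAlgebra K G) :
    ρ.vecGrp (mulGrp g y) = ρ.vecGrp y * ρ.grp g := by
  induction y using tmul_single_induction with
  | h0 => simp
  | hadd y z hy hz => simp [hy, hz, add_mul]
  | hs x h => simp [mulGrp, mul_assoc]

theorem grp_mul_vecGrp (g : G) (y : V ⊗[K] MonoidAlgebra K G) :
    ρ.grp g * ρ.vecGrp y = ρ.vecGrp (adjointAction g y) * ρ.grp g := by
  induction y using tmul_single_induction with
  | h0 => simp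
  | hadd y z hy hz => simp [hy, hz, add_mul, mul_add]
  | hs x h =>
    simp [adjointAction, mul_assoc]
    rw [← mul_assoc, ρ.grp_mul_vec, mul_assoc, ← map_mul, ← map_mul, mul_comm]

variable {v} {χ : Fin n → G →* Kˣ} (hχ : ∀ (g : G) (i : Fin n), g • v i = (χ i g : K) • v i)

omit [SMulCommClass G K V] in
include hχ in
theorem grp_mul_vec_basis (g : G) (i : Fin n) :
    ρ.grp g * ρ.vec (v i) = (χ i g : K) • (ρ.vec (v i) * ρ.grp g) := by
  rw [grp_mul_vec, hχ, map_smul, smul_mul_assoc]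

omit [SMulCommClass G K V] in
include hχ in
theorem grp_mul_wordProd (g : G) (w : List (Fin n)) :
    ρ.grp g * ρ.wordProd v w = (wordChar χ w g : K) • (ρ.wordProd v w * ρ.grp g) := by
  induction w with
  | nil => simp
  | cons i w ih =>
    rw [wordProd_cons, ← mul_assoc, ρ.grp_mul_vec_basis hχ, smul_mul_assoc, mul_assoc, ih,
      mul_smul_comm, smul_smul, ← mul_assoc]
    simp

end CovariantPair

/-! ### The word basis of the skew group algebra -/

section SkewGroupAlgebra

variable [SMulCommClass G K V] {n : ℕ} (v : Module.Basis (Fin n) K V)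

variable (K G V) in
/-- The covariant pair of the inclusions into `T(V) ⋊ G`. -/
def skewPair : CovariantPair K G V (SkewGroupAlgebra K G V) where
  vec := QuantumDrinfeld.vec K G V
  grp := QuantumDrinfeld.grp K G V
  grp_mul_vec g x := by
    change (SkewMonoidAlgebra.single g 1 * SkewMonoidAlgebra.single 1 (TensorAlgebra.ι K x) :
        SkewGroupAlgebra K G V) =
      SkewMonoidAlgebra.single 1 (TensorAlgebra.ι K (g • x)) * SkewMonoidAlgebra.single g 1
    simp [SkewMonoidAlgebra.single_mul_single]

variable (K G) in
/-- The words in the basis vectors times the group elements form a basis of `T(V) ⋊ G`. -/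
def wordBasis : Module.Basis (List (Fin n) × G) K (SkewGroupAlgebra K G V) :=
  ((Finsupp.basis fun _ : G => v.tensorAlgebra.reindex FreeMonoid.toList).map
    (SkewMonoidAlgebra.coeffLinearEquiv (k := TensorAlgebra K V) (G := G) (S := K)).symm).reindex
    ((Equiv.sigmaEquivProd G (List (Fin n))).trans (Equiv.prodComm _ _))

theorem tensorAlgebra_basis_apply (w : List (Fin n)) :
    v.tensorAlgebra (FreeMonoid.ofList w) = (w.map fun i => TensorAlgebra.ι K (v i)).prod := by
  have h1 : FreeAlgebra.basisFreeMonoid K (Fin n) (FreeMonoid.ofList w) =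
      (w.map (FreeAlgebra.ι K)).prod := by
    rw [FreeAlgebra.basisFreeMonoid, Module.Basis.map_apply]
    change MonoidAlgebra.lift K (FreeAlgebra K (Fin n)) (FreeMonoid (Fin n))
      (FreeMonoid.lift (FreeAlgebra.ι K)) (MonoidAlgebra.single _ 1) = _
    simp [FreeMonoid.lift_apply]
  rw [Module.Basis.tensorAlgebra, Module.Basis.map_apply, h1]
  change (TensorAlgebra.equivFreeAlgebra v).symm _ = _
  rw [map_list_prod, List.map_map]
  congr 2
  funext i
  simp

theorem skewPair_wordProd (w : List (Fin n)) :
    (skewPair K G V).wordProd v w =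
      SkewMonoidAlgebra.single 1 (v.tensorAlgebra (FreeMonoid.ofList w)) := by
  rw [tensorAlgebra_basis_apply]
  induction w with
  | nil => rfl
  | cons i w ih =>
    rw [CovariantPair.wordProd_cons, ih, List.map_cons, List.prod_cons]
    change (SkewMonoidAlgebra.single 1 (TensorAlgebra.ι K (v i)) * SkewMonoidAlgebra.single 1 _ :
        SkewGroupAlgebra K G V) = _
    simp [SkewMonoidAlgebra.single_mul_single]

theorem wordBasis_apply (x : List (Fin n) × G) :
    wordBasis K G v x = (skewPair K G V).wordProd v x.1 * (skewPair K G V).grp x.2 := by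
  rw [skewPair_wordProd]
  change _ = (SkewMonoidAlgebra.single 1 _ * SkewMonoidAlgebra.single x.2 1 :
        SkewGroupAlgebra K G V)
  rw [wordBasis, Module.Basis.reindex_apply, Module.Basis.map_apply]
  simp only [Equiv.symm_trans_apply, Equiv.prodComm_symm, Equiv.prodComm_apply,
    Equiv.sigmaEquivProd_symm_apply, Finsupp.coe_basis, Module.Basis.reindex_apply]
  rw [SkewMonoidAlgebra.single_mul_single, one_mul, smul_one, mul_one]
  rfl

end SkewGroupAlgebra

end

noncomputable section

/-! ### Sorted words, descents and the shortlex order -/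

section Words

variable {n : ℕ}

/-- The weakly increasing word with prescribed multiplicities. -/
def sortedWord (m : Fin n → ℕ) : List (Fin n) :=
  (List.ofFn fun i => List.replicate (m i) i).flatten

theorem count_sortedWord (m : Fin n → ℕ) (i : Fin n) : (sortedWord m).count i = m i := by
  simp [sortedWord, List.count_flatten, List.map_ofFn, List.sum_ofFn, Function.comp_def,
    List.count_replicate]

theorem pairwise_sortedWord (m : Fin n → ℕ) : (sortedWord m).Pairwise (· ≤ ·) := by
  rw [sortedWord, List.pairwise_flatten]
  constructor
  · intro l hl
    obtain ⟨i, rfl⟩ := (List.mem_ofFn' _ _).1 hl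
    simp [List.pairwise_replicate]
  · rw [List.pairwise_ofFn]
    intro i j hij x hx y hy
    rw [List.eq_of_mem_replicate hx, List.eq_of_mem_replicate hy]
    exact hij.le

theorem sortedWord_injective : Function.Injective (sortedWord (n := n)) := by
  intro m m' h
  funext i
  rw [← count_sortedWord m, h, count_sortedWord]

theorem eq_sortedWord {w : List (Fin n)} (hw : w.Pairwise (· ≤ ·)) :
    w = sortedWord fun i => w.count i :=
  List.Perm.eq_of_pairwise' hw (pairwise_sortedWord _)
    (List.perm_iff_count.2 fun i => (count_sortedWord (fun i => w.count i) i).symm)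

theorem pairwise_or_exists_descent (w : List (Fin n)) :
    w.Pairwise (· ≤ ·) ∨ ∃ u a b w', b < a ∧ w = u ++ a :: b :: w' := by
  induction w with
  | nil => simp
  | cons x w ih =>
    rcases ih with ih | ⟨u, a, b, w', hab, rfl⟩
    · cases w with
      | nil => simp
      | cons y w =>
        rcases le_or_gt x y with h | h
        · left
          rw [List.pairwise_cons]
          refine ⟨?_, ih⟩
          intro z hz
          rcases List.mem_cons.1 hz with rfl | hz
          · exact h
          · exact h.trans ((List.pairwise_cons.1 ih).1 z hz)
        · exact Or.inr ⟨[], x, y, w, h, rfl⟩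
    · exact Or.inr ⟨x :: u, a, b, w', hab, rfl⟩

theorem not_pairwise_of_descent {u w : List (Fin n)} {a b : Fin n} (hab : b < a) :
    ¬ (u ++ a :: b :: w).Pairwise (· ≤ ·) := by
  intro h
  have h1 := (List.pairwise_append.1 h).2.1
  exact absurd ((List.pairwise_cons.1 h1).1 b (by simp)) (not_le.2 hab)

/-- Lexicographic order does not survive appending on the right when s is a proper prefix of t;
equal lengths exclude that case. -/
theorem shortlex_append_right {s t : List (Fin n)} (u w : List (Fin n))
    (hl : s.length = t.length) (h : List.Lex (· < ·) s t) :
    List.Shortlex (· < ·) (u ++ s ++ w) (u ++ t ++ w) := by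
  refine List.Shortlex.of_lex (by simp [hl]) ?_
  rw [List.append_assoc, List.append_assoc]
  refine List.Lex.append_left _ ?_ u
  clear u
  induction h with
  | nil => simp at hl
  | cons h ih => exact List.Lex.cons (ih (by simpa using hl))
  | rel h => exact List.Lex.rel h

end Words

section

variable {K G V : Type*} [Field K] [CommGroup G] [AddCommGroup V] [Module K V]
  [DistribMulAction G V] [SMulCommClass G K V] {n : ℕ} (v : Module.Basis (Fin n) K V)

theorem monomial_eq_wordBasis (p : (Fin n → ℕ) × G) :
    monomial v p = wordBasis K G v (sortedWord p.1, p.2) := by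
  rw [wordBasis_apply, monomial, CovariantPair.wordProd, sortedWord, List.map_flatten,
    List.prod_flatten, List.map_map, List.map_ofFn]
  simp only [Function.comp_def, List.map_replicate, List.prod_replicate]
  rfl

end

end

/-! ### Relators and the quantum Jacobi identity -/

noncomputable section

set_option linter.unusedSectionVars false

variable {K G V : Type*} [Field K] [CommGroup G] [AddCommGroup V] [Module K V]
  [DistribMulAction G V] [SMulCommClass G K V] {n : ℕ} {v : Module.Basis (Fin n) K V}
  {q : Fin n → Fin n → K} {κ : V →ₗ[K] V →ₗ[K] V ⊗[K] MonoidAlgebra K G}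

-- Since q_ii = 1, antisymmetry gives 2κ(v_i, v_i) = 0. This is where characteristic zero enters.
omit [DistribMulAction G V] [SMulCommClass G K V] in
theorem IsQuantumAntisymm.self_eq_zero [CharZero K] (hκ : IsQuantumAntisymm v q κ)
    (hq : IsQuantumSystem q) (i : Fin n) : κ (v i) (v i) = 0 := by
  have h := hκ i i
  rw [hq.diag, one_smul, eq_neg_iff_add_eq_zero, ← two_smul K] at h
  exact (smul_eq_zero.1 h).resolve_left two_ne_zero

variable (v q κ) in
/-- The compatibility of the coefficients of `κ` with the quantum system and the characters, by
which the quadratic part of the Jacobi expression vanishes. -/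
def IsCompatible (χ : Fin n → G →* Kˣ) : Prop :=
  ∀ (g : G) (i j k : Fin n), i ≠ j → j ≠ k → i ≠ k →
    (∀ r : Fin n, r ≠ i → r ≠ j →
      0 = ((χ k g : K) - q j k * q i k * q k r) * coef v κ r i j g) ∧
    0 = (1 - q i j * (χ i g : K)) * coef v κ k j k g
      + (q j k - (χ k g : K)) * coef v κ i i j g

variable {A : Type*} [Ring A] [Algebra K A] (ρ : CovariantPair K G V A)

namespace CovariantPair

variable (v q κ) in
/-- The defining relation `v_i v_j - q_ij v_j v_i - κ(v_i, v_j)` as an element of an algebra. -/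
def relator (i j : Fin n) : A :=
  ρ.vec (v i) * ρ.vec (v j) - q i j • (ρ.vec (v j) * ρ.vec (v i))
    - ρ.vecGrp (κ (v i) (v j))

theorem vec_mul_vec (i j : Fin n) :
    ρ.vec (v i) * ρ.vec (v j) = ρ.relator v q κ i j +
      q i j • (ρ.vec (v j) * ρ.vec (v i)) + ρ.vecGrp (κ (v i) (v j)) := by
  rw [relator]; abel

theorem relator_self [CharZero K] (hκ : IsQuantumAntisymm v q κ) (hq : IsQuantumSystem q)
    (i : Fin n) : ρ.relator v q κ i i = 0 := by
  simp [relator, hκ.self_eq_zero hq, hq.diag]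

/-- This is what allows rewriting rules to be attached to descents only. -/
theorem relator_swap (hκ : IsQuantumAntisymm v q κ) (hq : IsQuantumSystem q) (i j : Fin n) :
    ρ.relator v q κ i j = -(q i j • ρ.relator v q κ j i) := by
  rw [relator, relator, hκ i j, smul_sub, smul_sub, smul_smul, hq.symm j i,
    inv_mul_cancel₀ (hq.ne_zero j i), one_smul, map_neg, map_smul]
  abel

/-- By invariance κ(v_i, v_j) has the same weight χ_i χ_j as the quadratic part, so group elements
pass through relators up to a scalar. -/
theorem grp_mul_relator {χ : Fin n → G →* Kˣ}
    (hχ : ∀ (g : G) (i : Fin n), g • v i = (χ i g : K) • v i) (hinv : IsInvariant κ)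
    (g : G) (i j : Fin n) :
    ρ.grp g * ρ.relator v q κ i j =
      ((χ i g : K) * χ j g) • (ρ.relator v q κ i j * ρ.grp g) := by
  have h2 : ∀ a b, ρ.grp g * (ρ.vec (v a) * ρ.vec (v b)) =
      ((χ a g : K) * χ b g) • (ρ.vec (v a) * ρ.vec (v b) * ρ.grp g) := by
    intro a b
    rw [← mul_assoc, ρ.grp_mul_vec_basis hχ, smul_mul_assoc, mul_assoc, ρ.grp_mul_vec_basis hχ,
      mul_smul_comm, smul_smul, mul_assoc]
  have h3 : adjointAction g (κ (v i) (v j)) = ((χ i g : K) * χ j g) • κ (v i) (v j) := by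
    rw [← hinv, hχ, hχ, map_smul, map_smul, LinearMap.smul_apply, smul_smul, mul_comm]
  rw [relator, mul_sub, mul_sub, mul_smul_comm, h2, h2, ρ.grp_mul_vecGrp, h3, sub_mul, sub_mul,
    smul_sub, smul_sub, smul_mul_assoc, map_smul, smul_mul_assoc, smul_comm (q i j),
    mul_comm (χ j g : K)]

/-- The quantum Jacobi identity for the quadratic parts of the relators. -/
theorem quantum_jacobi (i j k : Fin n) :
    (q k i • (ρ.relator v q κ i j * ρ.vec (v k)) - q j k • (ρ.vec (v k) * ρ.relator v q κ i j))
    + (q i j • (ρ.relator v q κ j k * ρ.vec (v i)) -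
        q k i • (ρ.vec (v i) * ρ.relator v q κ j k))
    + (q j k • (ρ.relator v q κ k i * ρ.vec (v j)) -
        q i j • (ρ.vec (v j) * ρ.relator v q κ k i)) =
    -((q k i • (ρ.vecGrp (κ (v i) (v j)) * ρ.vec (v k)) -
        q j k • (ρ.vec (v k) * ρ.vecGrp (κ (v i) (v j))))
    + (q i j • (ρ.vecGrp (κ (v j) (v k)) * ρ.vec (v i)) -
        q k i • (ρ.vec (v i) * ρ.vecGrp (κ (v j) (v k))))
    + (q j k • (ρ.vecGrp (κ (v k) (v i)) * ρ.vec (v j)) -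
        q i j • (ρ.vec (v j) * ρ.vecGrp (κ (v k) (v i))))) := by
  -- After expansion the twelve cubic terms cancel in pairs, without any property of q.
  simp only [relator, mul_sub, sub_mul, smul_mul_assoc, mul_smul_comm, mul_assoc]
  module

theorem vec_eq_sum (w : V) :
    ρ.vec w = ∑ r, v.repr w r • ρ.vec (v r) := by
  conv_lhs => rw [← v.sum_repr w, map_sum]
  simp only [map_smul]

theorem vecGrp_kappa_eq_sum {S : Finset G} {i j : Fin n}
    (hS : (components K G V (κ (v i) (v j))).support ⊆ S) :
    ρ.vecGrp (κ (v i) (v j)) =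
      ∑ h ∈ S, ∑ r, coef v κ r i j h • (ρ.vec (v r) * ρ.grp h) := by
  rw [ρ.vecGrp_eq_sum, Finsupp.sum_of_support_subset _ hS _ (by simp)]
  refine Finset.sum_congr rfl fun h _ => ?_
  rw [ρ.vec_eq_sum (v := v), Finset.sum_mul]
  simp [coef, comp]

theorem jacobi_term_eq_sum {χ : Fin n → G →* Kˣ}
    (hχ : ∀ (g : G) (i : Fin n), g • v i = (χ i g : K) • v i) {S : Finset G} {i j : Fin n}
    (k : Fin n) (hS : (components K G V (κ (v i) (v j))).support ⊆ S) :
    q k i • (ρ.vecGrp (κ (v i) (v j)) * ρ.vec (v k)) -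
        q j k • (ρ.vec (v k) * ρ.vecGrp (κ (v i) (v j))) =
    ∑ h ∈ S, ∑ r, coef v κ r i j h •
      ((q k i * χ k h) • (ρ.vec (v r) * ρ.vec (v k)) -
        q j k • (ρ.vec (v k) * ρ.vec (v r))) * ρ.grp h := by
  rw [ρ.vecGrp_kappa_eq_sum hS, Finset.sum_mul, Finset.mul_sum, Finset.smul_sum, Finset.smul_sum,
    ← Finset.sum_sub_distrib]
  refine Finset.sum_congr rfl fun h _ => ?_
  rw [Finset.sum_mul, Finset.mul_sum, Finset.smul_sum, Finset.smul_sum, ← Finset.sum_sub_distrib]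
  refine Finset.sum_congr rfl fun r _ => ?_
  simp only [sub_mul, smul_mul_assoc, mul_smul_comm, mul_assoc, ρ.grp_mul_vec_basis hχ, smul_sub]
  module

theorem vecGrp_jacobiSummand {χ : Fin n → G →* Kˣ} {S : Finset G} {i j : Fin n}
    (k : Fin n) (hS : (components K G V (κ (v i) (v j))).support ⊆ S) :
    ρ.vecGrp (jacobiSummand v χ q κ i j k) =
      ∑ h ∈ S, ((((χ k h : K) - q j k) * coef v κ i i j h) • ρ.vecGrp (κ (v k) (v i)) +
        q j k • ∑ r, coef v κ r i j h • ρ.vecGrp (κ (v k) (v r))) * ρ.grp h := by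
  rw [jacobiSummand, Finsupp.sum_of_support_subset _ hS _ (by simp), map_sum]
  refine Finset.sum_congr rfl fun h _ => ?_
  have h1 : κ (v k) (components K G V (κ (v i) (v j)) h) =
      ∑ r, coef v κ r i j h • κ (v k) (v r) := by
    conv_lhs => rw [← v.sum_repr (components K G V (κ (v i) (v j)) h), map_sum]
    simp only [map_smul, coef, comp]
  rw [ρ.vecGrp_mulGrp, h1]
  simp [coef, comp]

variable (v q κ) in
/-- The span of the right multiples of the relators by group elements. -/
def relatorSpan : Submodule K (A) :=
  Submodule.span K {e | ∃ i j h, e = ρ.relator v q κ i j * ρ.grp h}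

theorem relator_mul_grp_mem (i j : Fin n) (h : G) :
    ρ.relator v q κ i j * ρ.grp h ∈ ρ.relatorSpan v q κ :=
  Submodule.subset_span ⟨i, j, h, rfl⟩

/-- Modulo relators, v_k v_r is q_kr v_r v_k + κ(v_k, v_r). The coefficient of v_r v_k becomes
c_r^{ijh} (q_ki χ_k(h) - q_jk q_kr), which vanishes for r ≠ i, j by the first half of compatibility.
The cases r = i and r = j survive as the two subtracted products; writing the former with v_k v_i
instead of v_i v_k accounts for the κ(v_k, v_i) part of the Jacobi summand. -/
theorem jacobi_component_mem {χ : Fin n → G →* Kˣ} (hq : IsQuantumSystem q)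
    (hc : IsCompatible v q κ χ) {i j k : Fin n} (hij : i ≠ j) (hjk : j ≠ k) (hik : i ≠ k) (h : G) :
    (∑ r, coef v κ r i j h •
      ((q k i * χ k h) • (ρ.vec (v r) * ρ.vec (v k)) -
        q j k • (ρ.vec (v k) * ρ.vec (v r))) * ρ.grp h) +
    ((((χ k h : K) - q j k) * coef v κ i i j h) • ρ.vecGrp (κ (v k) (v i)) +
        q j k • ∑ r, coef v κ r i j h • ρ.vecGrp (κ (v k) (v r))) * ρ.grp h -
    ((((χ k h : K) - q j k) * coef v κ i i j h) • (ρ.vec (v k) * ρ.vec (v i)) +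
      ((q k i * χ k h - 1) * coef v κ j i j h) • (ρ.vec (v j) * ρ.vec (v k))) *
        ρ.grp h ∈ ρ.relatorSpan v q κ := by
  have h1 : ∀ r, coef v κ r i j h •
      ((q k i * χ k h) • (ρ.vec (v r) * ρ.vec (v k)) -
        q j k • (ρ.vec (v k) * ρ.vec (v r))) =
      ((if r = i then (q k i * ((χ k h : K) - q j k) * coef v κ i i j h) •
            (ρ.vec (v i) * ρ.vec (v k)) else 0) +
        (if r = j then ((q k i * χ k h - 1) * coef v κ j i j h) •
            (ρ.vec (v j) * ρ.vec (v k)) else 0)) -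
      (q j k * coef v κ r i j h) • ρ.relator v q κ k r -
      q j k • coef v κ r i j h • ρ.vecGrp (κ (v k) (v r)) := by
    intro r
    rw [ρ.vec_mul_vec (q := q) (κ := κ) k r]
    have e1 : q j k * q k j = 1 := by rw [hq.symm j k, mul_inv_cancel₀ (hq.ne_zero j k)]
    have e2 : q k i * q i k = 1 := by rw [hq.symm k i, mul_inv_cancel₀ (hq.ne_zero k i)]
    have e3 : (coef v κ r i j h * (q k i * χ k h - q j k * q k r)) •
          (ρ.vec (v r) * ρ.vec (v k)) =
        ((if r = i then (q k i * ((χ k h : K) - q j k) * coef v κ i i j h) •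
            (ρ.vec (v i) * ρ.vec (v k)) else 0) +
        (if r = j then ((q k i * χ k h - 1) * coef v κ j i j h) •
            (ρ.vec (v j) * ρ.vec (v k)) else 0)) := by
      rcases eq_or_ne r i with rfl | hri
      · rw [if_pos rfl, if_neg hij, add_zero]
        congr 1
        ring
      · rcases eq_or_ne r j with rfl | hrj
        · rw [if_neg hri, if_pos rfl, zero_add]
          congr 1
          linear_combination -coef v κ r i r h * e1
        · rw [if_neg hri, if_neg hrj, add_zero]
          have e4 := ((hc h i j k hij hjk hik).1 r hri hrj)
          have e5 : coef v κ r i j h * (q k i * χ k h - q j k * q k r) = 0 := by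
            linear_combination -q k i * e4 + q j k * q k r * coef v κ r i j h * e2
          rw [e5, zero_smul]
    rw [← e3]
    module
  simp only [h1, ← Finset.sum_mul, Finset.sum_sub_distrib, Finset.sum_add_distrib,
    Finset.sum_ite_eq', Finset.mem_univ, if_true, ← Finset.smul_sum]
  rw [ρ.vec_mul_vec (q := q) (κ := κ) k i]
  have h2 : ∑ r, (q j k * coef v κ r i j h) • ρ.relator v q κ k r * ρ.grp h +
      (((χ k h : K) - q j k) * coef v κ i i j h) • (ρ.relator v q κ k i * ρ.grp h) ∈
        ρ.relatorSpan v q κ := by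
    refine add_mem (sum_mem fun r _ => ?_) (Submodule.smul_mem _ _ (ρ.relator_mul_grp_mem _ _ _))
    rw [smul_mul_assoc]
    exact Submodule.smul_mem _ _ (ρ.relator_mul_grp_mem _ _ _)
  rw [← neg_mem_iff]
  convert h2 using 1
  rw [← Finset.sum_mul]
  simp only [add_mul, sub_mul, smul_mul_assoc, Finset.sum_mul]
  module

/-- Each cyclic term leaves two quadratic residues, and by the second half of compatibility the v_j
v_k residue of (i, j, k) cancels that of (k, i, j), and so on cyclically. The lemma serves both
directions of the theorem. -/
theorem jacobi_sum_mem {χ : Fin n → G →* Kˣ}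
    (hχ : ∀ (g : G) (i : Fin n), g • v i = (χ i g : K) • v i) (hq : IsQuantumSystem q)
    (hc : IsCompatible v q κ χ) {i j k : Fin n} (hij : i ≠ j) (hjk : j ≠ k) (hik : i ≠ k) :
    ((q k i • (ρ.vecGrp (κ (v i) (v j)) * ρ.vec (v k)) -
        q j k • (ρ.vec (v k) * ρ.vecGrp (κ (v i) (v j))))
    + (q i j • (ρ.vecGrp (κ (v j) (v k)) * ρ.vec (v i)) -
        q k i • (ρ.vec (v i) * ρ.vecGrp (κ (v j) (v k))))
    + (q j k • (ρ.vecGrp (κ (v k) (v i)) * ρ.vec (v j)) -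
        q i j • (ρ.vec (v j) * ρ.vecGrp (κ (v k) (v i))))) +
    ρ.vecGrp (jacobiSummand v χ q κ i j k + jacobiSummand v χ q κ j k i +
      jacobiSummand v χ q κ k i j) ∈ ρ.relatorSpan v q κ := by
  classical
  obtain ⟨S, h1, h2, h3⟩ : ∃ S : Finset G,
      (components K G V (κ (v i) (v j))).support ⊆ S ∧
      (components K G V (κ (v j) (v k))).support ⊆ S ∧
      (components K G V (κ (v k) (v i))).support ⊆ S :=
    ⟨(components K G V (κ (v i) (v j))).support ∪ (components K G V (κ (v j) (v k))).support ∪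
      (components K G V (κ (v k) (v i))).support, by grind, by grind, by grind⟩
  rw [map_add, map_add, ρ.jacobi_term_eq_sum hχ k h1, ρ.jacobi_term_eq_sum hχ i h2,
    ρ.jacobi_term_eq_sum hχ j h3, ρ.vecGrp_jacobiSummand k h1, ρ.vecGrp_jacobiSummand i h2,
    ρ.vecGrp_jacobiSummand j h3]
  simp only [← Finset.sum_add_distrib]
  refine sum_mem fun h _ => ?_
  have m1 := ρ.jacobi_component_mem hq hc hij hjk hik h
  have m2 := ρ.jacobi_component_mem hq hc hjk hik.symm hij.symm h
  have m3 := ρ.jacobi_component_mem hq hc hik.symm hij hjk.symm h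
  have e1 := (hc h i j k hij hjk hik).2
  have e2 := (hc h j k i hjk hik.symm hij.symm).2
  have e3 := (hc h k i j hik.symm hij hjk.symm).2
  have d1 : (q i j * χ i h - 1) * coef v κ k j k h =
    -(((χ k h : K) - q j k) * coef v κ i i j h) := by linear_combination e1
  have d2 : (q j k * χ j h - 1) * coef v κ i k i h =
    -(((χ i h : K) - q k i) * coef v κ j j k h) := by linear_combination e2
  have d3 : (q k i * χ k h - 1) * coef v κ j i j h =
    -(((χ j h : K) - q i j) * coef v κ k k i h) := by linear_combination e3
  rw [d3] at m1
  rw [d1] at m2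
  rw [d2] at m3
  have m := add_mem (add_mem m1 m2) m3
  convert m using 1
  simp only [Finset.sum_add_distrib, add_mul, neg_smul, neg_mul]
  abel

end CovariantPair

end

/-! ### Descent relations and resolution of ambiguities -/

noncomputable section

set_option linter.unusedSectionVars false

open LinearRewriting

variable {K G V : Type*} [Field K] [CommGroup G] [AddCommGroup V] [Module K V]
  [DistribMulAction G V] [SMulCommClass G K V] {n : ℕ} {v : Module.Basis (Fin n) K V}
  {q : Fin n → Fin n → K} {κ : V →ₗ[K] V →ₗ[K] V ⊗[K] MonoidAlgebra K G}
  {A : Type*} [Ring A] [Algebra K A] (ρ : CovariantPair K G V A)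
  {χ : Fin n → G →* Kˣ}

/-- The order on words times group elements: shortlex on the words. -/
def wordOrder (x y : List (Fin n) × G) : Prop := List.Shortlex (· < ·) x.1 y.1

theorem wordOrder_wf : WellFounded (wordOrder (n := n) (G := G)) :=
  InvImage.wf Prod.fst (List.Shortlex.wf wellFounded_lt)

theorem wordOrder_of_length_lt {x y : List (Fin n) × G} (h : x.1.length < y.1.length) :
    wordOrder x y := List.Shortlex.of_length_lt h

theorem wordOrder_lex {s t : List (Fin n)} (u w : List (Fin n)) (g g' : G)
    (hl : s.length = t.length) (h : List.Lex (· < ·) s t) :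
    wordOrder (u ++ s ++ w, g) (u ++ t ++ w, g') :=
  shortlex_append_right u w hl h

namespace CovariantPair

variable (v q κ) in
/-- The relations attached to the descents of a word. -/
inductive DescentRelation : List (Fin n) × G → A → Prop
  | mk (u : List (Fin n)) (a b : Fin n) (w : List (Fin n)) (g : G) (h : b < a) :
    DescentRelation (u ++ a :: b :: w, g)
      (ρ.wordProd v u * ρ.relator v q κ a b * ρ.wordProd v w * ρ.grp g)

theorem vecGrp_mem_of_forall {N : Submodule K A} {x z : A}
    (h : ∀ r g, x * (ρ.vec (v r) * ρ.grp g) * z ∈ N) (y : V ⊗[K] MonoidAlgebra K G) :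
    x * ρ.vecGrp y * z ∈ N := by
  rw [ρ.vecGrp_eq_sum, Finsupp.sum, Finset.mul_sum, Finset.sum_mul]
  refine sum_mem fun g _ => ?_
  rw [ρ.vec_eq_sum (v := v), Finset.sum_mul, Finset.mul_sum, Finset.sum_mul]
  refine sum_mem fun r _ => ?_
  rw [smul_mul_assoc, mul_smul_comm, smul_mul_assoc]
  exact N.smul_mem _ (h r g)

theorem relatorSpan_mem_of_forall {N : Submodule K A} {x z : A}
    (h : ∀ a b g, x * (ρ.relator v q κ a b * ρ.grp g) * z ∈ N) {y : A}
    (hy : y ∈ ρ.relatorSpan v q κ) : x * y * z ∈ N := by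
  have h1 : ρ.relatorSpan v q κ ≤
      N.comap ((LinearMap.mulRight K z).comp (LinearMap.mulLeft K x)) := by
    refine Submodule.span_le.2 ?_
    rintro _ ⟨a, b, g, rfl⟩
    exact h a b g
  exact h1 hy

section

variable (hχ : ∀ (g : G) (i : Fin n), g • v i = (χ i g : K) • v i)

include hχ in
theorem grp_mul_wordProd_mul_grp (h : G) (w : List (Fin n)) (g : G) :
    ρ.grp h * ρ.wordProd v w * ρ.grp g =
      (wordChar χ w h : K) • (ρ.wordProd v w * ρ.grp (h * g)) := by
  rw [ρ.grp_mul_wordProd hχ, smul_mul_assoc, mul_assoc, map_mul]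

variable {b : Module.Basis (List (Fin n) × G) K A}
  (hb : ∀ x, b x = ρ.wordProd v x.1 * ρ.grp x.2)

include hb in
theorem wordProd_mul_grp_mem_lowerSpan {x : List (Fin n) × G} {w : List (Fin n)} {g : G}
    (h : wordOrder (w, g) x) : ρ.wordProd v w * ρ.grp g ∈ lowerSpan b wordOrder x :=
  Submodule.subset_span ⟨(w, g), h, hb _⟩

-- Swapping a descent lowers the word lexicographically at equal length, and the κ terms are shorter
-- by one letter.
include hχ hb in
theorem sub_mem_lowerSpan {x : List (Fin n) × G} {e : A} (h : ρ.DescentRelation v q κ x e) :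
    b x - e ∈ lowerSpan b wordOrder x := by
  obtain ⟨u, a, c, w, g, hca⟩ := h
  have h1 : b (u ++ a :: c :: w, g) -
      ρ.wordProd v u * ρ.relator v q κ a c * ρ.wordProd v w * ρ.grp g =
      q a c • (ρ.wordProd v (u ++ c :: a :: w) * ρ.grp g) +
      ρ.wordProd v u * ρ.vecGrp (κ (v a) (v c)) * (ρ.wordProd v w * ρ.grp g) := by
    rw [hb]
    simp only [relator, wordProd_append, wordProd_cons, mul_sub, sub_mul, smul_mul_assoc,
      mul_smul_comm, mul_assoc]
    abel
  rw [h1]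
  refine add_mem (Submodule.smul_mem _ _ ?_) (ρ.vecGrp_mem_of_forall (v := v) (fun r h => ?_) _)
  · refine ρ.wordProd_mul_grp_mem_lowerSpan hb ?_
    simpa using wordOrder_lex u w g g (s := [c, a]) (t := [a, c]) rfl (List.Lex.rel hca)
  · have h2 : ρ.wordProd v u * (ρ.vec (v r) * ρ.grp h) * (ρ.wordProd v w * ρ.grp g) =
        (wordChar χ w h : K) • (ρ.wordProd v (u ++ r :: w) * ρ.grp (h * g)) := by
      have := ρ.grp_mul_wordProd_mul_grp hχ h w g
      rw [mul_assoc] at this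
      rw [mul_assoc, mul_assoc, this]
      simp only [mul_smul_comm, wordProd_append, wordProd_cons, mul_assoc]
    rw [h2]
    exact Submodule.smul_mem _ _ (ρ.wordProd_mul_grp_mem_lowerSpan hb
      (wordOrder_of_length_lt (by simp)))

end

variable [CharZero K] (hκ : IsQuantumAntisymm v q κ) (hq : IsQuantumSystem q)

-- If a < b, the relator is rewritten through its swap, whose leading word is the other one; hence
-- the bounds on both words.
include hκ hq in
theorem relator_mem_lowerRelations {x : List (Fin n) × G} {u w : List (Fin n)} {a b : Fin n} (g : G)
    (h : wordOrder (u ++ a :: b :: w, g) x) (h' : wordOrder (u ++ b :: a :: w, g) x) :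
    ρ.wordProd v u * ρ.relator v q κ a b * ρ.wordProd v w * ρ.grp g ∈
      lowerRelations (R := K) wordOrder (ρ.DescentRelation v q κ) x := by
  rcases lt_trichotomy a b with hab | rfl | hab
  · rw [ρ.relator_swap hκ hq, mul_neg, mul_smul_comm, neg_mul, neg_mul, smul_mul_assoc,
      smul_mul_assoc]
    exact neg_mem (Submodule.smul_mem _ _ (Submodule.subset_span ⟨_, h', .mk u b a w g hab⟩))
  · simp [ρ.relator_self hκ hq]
  · exact Submodule.subset_span ⟨_, h, .mk u a b w g hab⟩

include hκ hq in
theorem relator_mem_relations (u w : List (Fin n)) (a b : Fin n) (g : G) :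
    ρ.wordProd v u * ρ.relator v q κ a b * ρ.wordProd v w * ρ.grp g ∈
      relations (R := K) (ρ.DescentRelation v q κ) := by
  rcases lt_trichotomy a b with hab | rfl | hab
  · rw [ρ.relator_swap hκ hq, mul_neg, mul_smul_comm, neg_mul, neg_mul, smul_mul_assoc,
      smul_mul_assoc]
    exact neg_mem (Submodule.smul_mem _ _ (Submodule.subset_span ⟨_, .mk u b a w g hab⟩))
  · simp [ρ.relator_self hκ hq]
  · exact Submodule.subset_span ⟨_, .mk u a b w g hab⟩

include hκ hq in
theorem relator_mem_of_length_lt {x : List (Fin n) × G} {u w : List (Fin n)} (a b : Fin n) (g : G)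
    (h : u.length + w.length + 2 < x.1.length) :
    ρ.wordProd v u * ρ.relator v q κ a b * ρ.wordProd v w * ρ.grp g ∈
      lowerRelations (R := K) wordOrder (ρ.DescentRelation v q κ) x :=
  ρ.relator_mem_lowerRelations hκ hq g (wordOrder_of_length_lt (by simp; omega))
    (wordOrder_of_length_lt (by simp; omega))

variable (hχ : ∀ (g : G) (i : Fin n), g • v i = (χ i g : K) • v i)

include hκ hq hχ in
theorem relatorSpan_mem_of_length_lt {x : List (Fin n) × G} {u w : List (Fin n)} (g : G)
    (h : u.length + w.length + 2 < x.1.length) {y : A} (hy : y ∈ ρ.relatorSpan v q κ) :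
    ρ.wordProd v u * y * (ρ.wordProd v w * ρ.grp g) ∈
      lowerRelations (R := K) wordOrder (ρ.DescentRelation v q κ) x := by
  refine ρ.relatorSpan_mem_of_forall (fun a b h' => ?_) hy
  have h1 : ρ.wordProd v u * (ρ.relator v q κ a b * ρ.grp h') * (ρ.wordProd v w * ρ.grp g) =
      (wordChar χ w h' : K) •
        (ρ.wordProd v u * ρ.relator v q κ a b * ρ.wordProd v w * ρ.grp (h' * g)) := by
    have := ρ.grp_mul_wordProd_mul_grp hχ h' w g
    rw [mul_assoc] at this
    rw [mul_assoc, mul_assoc, this]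
    simp only [mul_smul_comm, mul_assoc]
  rw [h1]
  exact Submodule.smul_mem _ _ (ρ.relator_mem_of_length_lt hκ hq a b _ h)

include hκ hq hχ in
theorem relator_mul_vecGrp_mem {x : List (Fin n) × G} {u s w : List (Fin n)} (a b : Fin n) (g : G)
    (h : u.length + s.length + w.length + 3 < x.1.length) (y : V ⊗[K] MonoidAlgebra K G) :
    ρ.wordProd v u * ρ.relator v q κ a b * ρ.wordProd v s * ρ.vecGrp y *
      (ρ.wordProd v w * ρ.grp g) ∈
      lowerRelations (R := K) wordOrder (ρ.DescentRelation v q κ) x := by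
  refine ρ.vecGrp_mem_of_forall (v := v) (fun r h' => ?_) y
  have h1 : ρ.wordProd v u * ρ.relator v q κ a b * ρ.wordProd v s * (ρ.vec (v r) * ρ.grp h') *
      (ρ.wordProd v w * ρ.grp g) = (wordChar χ w h' : K) •
        (ρ.wordProd v u * ρ.relator v q κ a b * ρ.wordProd v (s ++ r :: w) *
          ρ.grp (h' * g)) := by
    have := ρ.grp_mul_wordProd_mul_grp hχ h' w g
    rw [mul_assoc] at this
    rw [mul_assoc _ (ρ.vec (v r) * ρ.grp h'), mul_assoc (ρ.vec (v r)), this]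
    simp only [mul_smul_comm, wordProd_append, wordProd_cons, mul_assoc]
  rw [h1]
  exact Submodule.smul_mem _ _ (ρ.relator_mem_of_length_lt hκ hq a b _ (by simp; omega))

variable (hinv : IsInvariant κ)

include hχ hinv in
theorem grp_mul_relator_context (h : G) (u : List (Fin n)) (a b : Fin n) (w : List (Fin n))
    (g : G) :
    ρ.grp h * (ρ.wordProd v u * ρ.relator v q κ a b * ρ.wordProd v w * ρ.grp g) =
      ((wordChar χ u h : K) * (χ a h * χ b h) * wordChar χ w h) •
        (ρ.wordProd v u * ρ.relator v q κ a b * ρ.wordProd v w * ρ.grp (h * g)) := by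
  calc _ = ρ.grp h * ρ.wordProd v u * ρ.relator v q κ a b * ρ.wordProd v w * ρ.grp g := by
        simp only [mul_assoc]
    _ = (wordChar χ u h : K) • (ρ.wordProd v u * (ρ.grp h * ρ.relator v q κ a b) *
        ρ.wordProd v w * ρ.grp g) := by
        rw [ρ.grp_mul_wordProd hχ]
        simp only [smul_mul_assoc, mul_assoc]
    _ = ((wordChar χ u h : K) * (χ a h * χ b h)) • (ρ.wordProd v u * ρ.relator v q κ a b *
        (ρ.grp h * ρ.wordProd v w * ρ.grp g)) := by
        rw [ρ.grp_mul_relator hχ hinv, mul_smul_comm, smul_mul_assoc, smul_mul_assoc, smul_smul]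
        simp only [mul_assoc]
    _ = _ := by
        rw [ρ.grp_mul_wordProd_mul_grp hχ, mul_smul_comm, smul_smul]
        simp only [mul_assoc]

-- Here the group elements produced by κ stand to the left of the relator, so invariance is needed
-- to move them through it; `relator_mul_vecGrp_mem` has them on the right and does without.
include hκ hq hχ hinv in
theorem vecGrp_mul_relator_mem {x : List (Fin n) × G} {u s w : List (Fin n)} (a b : Fin n) (g : G)
    (h : u.length + s.length + w.length + 3 < x.1.length) (y : V ⊗[K] MonoidAlgebra K G) :
    ρ.wordProd v u * ρ.vecGrp y *
      (ρ.wordProd v s * ρ.relator v q κ a b * ρ.wordProd v w * ρ.grp g) ∈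
      lowerRelations (R := K) wordOrder (ρ.DescentRelation v q κ) x := by
  refine ρ.vecGrp_mem_of_forall (v := v) (fun r h' => ?_) y
  have h1 : ρ.wordProd v u * (ρ.vec (v r) * ρ.grp h') *
      (ρ.wordProd v s * ρ.relator v q κ a b * ρ.wordProd v w * ρ.grp g) =
      ((wordChar χ s h' : K) * (χ a h' * χ b h') * wordChar χ w h') •
        (ρ.wordProd v (u ++ r :: s) * ρ.relator v q κ a b * ρ.wordProd v w *
          ρ.grp (h' * g)) := by
    rw [mul_assoc, mul_assoc (ρ.vec (v r)), ρ.grp_mul_relator_context hχ hinv]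
    simp only [mul_smul_comm, wordProd_append, wordProd_cons, mul_assoc]
  rw [h1]
  exact Submodule.smul_mem _ _ (ρ.relator_mem_of_length_lt hκ hq a b _ (by simp; omega))

-- Expanding the untouched descent on each side produces the same term with two relators. It
-- cancels, and every other term has a smaller leading word.
include hκ hq hχ hinv in
theorem disjoint_resolvable (u : List (Fin n)) {a b : Fin n} (hab : b < a) (s : List (Fin n))
    {c d : Fin n} (hcd : d < c) (w : List (Fin n)) (g : G) :
    ρ.wordProd v u * ρ.relator v q κ a b * ρ.wordProd v (s ++ c :: d :: w) * ρ.grp g -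
      ρ.wordProd v (u ++ a :: b :: s) * ρ.relator v q κ c d * ρ.wordProd v w * ρ.grp g ∈
      lowerRelations (R := K) wordOrder (ρ.DescentRelation v q κ)
        (u ++ a :: b :: (s ++ c :: d :: w), g) := by
  have h1 : ρ.wordProd v u * ρ.relator v q κ a b * ρ.wordProd v (s ++ c :: d :: w) * ρ.grp g =
      ρ.wordProd v u * ρ.relator v q κ a b * ρ.wordProd v s * ρ.relator v q κ c d *
        ρ.wordProd v w * ρ.grp g +
      q c d • (ρ.wordProd v u * ρ.relator v q κ a b * ρ.wordProd v (s ++ d :: c :: w) * ρ.grp g) +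
      ρ.wordProd v u * ρ.relator v q κ a b * ρ.wordProd v s * ρ.vecGrp (κ (v c) (v d)) *
        (ρ.wordProd v w * ρ.grp g) := by
    have : ρ.wordProd v (s ++ c :: d :: w) =
        ρ.wordProd v s * (ρ.vec (v c) * ρ.vec (v d)) * ρ.wordProd v w := by
      simp [mul_assoc]
    rw [this, ρ.vec_mul_vec (q := q) (κ := κ)]
    simp only [wordProd_append, wordProd_cons, mul_add, add_mul, smul_mul_assoc, mul_smul_comm,
      mul_assoc]
  have h2 : ρ.wordProd v (u ++ a :: b :: s) * ρ.relator v q κ c d * ρ.wordProd v w * ρ.grp g =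
      ρ.wordProd v u * ρ.relator v q κ a b * ρ.wordProd v s * ρ.relator v q κ c d *
        ρ.wordProd v w * ρ.grp g +
      q a b • (ρ.wordProd v (u ++ b :: a :: s) * ρ.relator v q κ c d * ρ.wordProd v w * ρ.grp g) +
      ρ.wordProd v u * ρ.vecGrp (κ (v a) (v b)) *
        (ρ.wordProd v s * ρ.relator v q κ c d * ρ.wordProd v w * ρ.grp g) := by
    have : ρ.wordProd v (u ++ a :: b :: s) =
        ρ.wordProd v u * (ρ.vec (v a) * ρ.vec (v b)) * ρ.wordProd v s := by
      simp [mul_assoc]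
    rw [this, ρ.vec_mul_vec (q := q) (κ := κ)]
    simp only [wordProd_append, wordProd_cons, mul_add, add_mul, smul_mul_assoc, mul_smul_comm,
      mul_assoc]
  have o1 : wordOrder (u ++ a :: b :: (s ++ d :: c :: w), g)
      (u ++ a :: b :: (s ++ c :: d :: w), g) := by
    simpa using wordOrder_lex (u ++ a :: b :: s) w g g (s := [d, c]) (t := [c, d]) rfl
      (List.Lex.rel hcd)
  have o2 : wordOrder (u ++ b :: a :: (s ++ c :: d :: w), g)
      (u ++ a :: b :: (s ++ c :: d :: w), g) := by
    simpa using wordOrder_lex u (s ++ c :: d :: w) g g (s := [b, a]) (t := [a, b]) rfl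
      (List.Lex.rel hab)
  have m1 : ρ.wordProd v u * ρ.relator v q κ a b * ρ.wordProd v (s ++ d :: c :: w) * ρ.grp g ∈
      lowerRelations (R := K) wordOrder (ρ.DescentRelation v q κ)
        (u ++ a :: b :: (s ++ c :: d :: w), g) :=
    Submodule.subset_span ⟨_, o1, .mk u a b _ g hab⟩
  have m2 : ρ.wordProd v (u ++ b :: a :: s) * ρ.relator v q κ c d * ρ.wordProd v w * ρ.grp g ∈
      lowerRelations (R := K) wordOrder (ρ.DescentRelation v q κ)
        (u ++ a :: b :: (s ++ c :: d :: w), g) :=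
    Submodule.subset_span ⟨((u ++ b :: a :: s) ++ c :: d :: w, g), by simpa using o2,
      .mk _ c d w g hcd⟩
  have m3 := ρ.relator_mul_vecGrp_mem hκ hq hχ (x := (u ++ a :: b :: (s ++ c :: d :: w), g))
    (u := u) (s := s) (w := w) a b g (by simp; omega) (κ (v c) (v d))
  have m4 := ρ.vecGrp_mul_relator_mem hκ hq hχ hinv (x := (u ++ a :: b :: (s ++ c :: d :: w), g))
    (u := u) (s := s) (w := w) c d g (by simp; omega) (κ (v a) (v b))
  rw [h1, h2]
  convert sub_mem (add_mem (Submodule.smul_mem _ (q c d) m1) m3)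
    (add_mem (Submodule.smul_mem _ (q a b) m2) m4) using 1
  abel

variable (hc : IsCompatible v q κ χ)
  (hJ : ∀ i j k : Fin n, i ≠ j → j ≠ k → i ≠ k →
    0 = jacobiSummand v χ q κ i j k + jacobiSummand v χ q κ j k i + jacobiSummand v χ q κ k i j)

-- The quantum Jacobi sum lies in the span of relators times group elements, hence in the span of
-- relations on shorter words.
include hκ hq hχ hc hJ in
theorem overlap_resolvable (u : List (Fin n)) {i j k : Fin n} (hji : j < i) (hkj : k < j)
    (w : List (Fin n)) (g : G) :
    ρ.wordProd v u * ρ.relator v q κ i j * ρ.wordProd v (k :: w) * ρ.grp g -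
      ρ.wordProd v (u ++ [i]) * ρ.relator v q κ j k * ρ.wordProd v w * ρ.grp g ∈
      lowerRelations (R := K) wordOrder (ρ.DescentRelation v q κ) (u ++ i :: j :: k :: w, g) := by
  have hki := hkj.trans hji
  have hs := ρ.jacobi_sum_mem hχ hq hc hji.ne' hkj.ne' hki.ne'
  rw [← hJ i j k hji.ne' hkj.ne' hki.ne', map_zero, add_zero] at hs
  have hs' := ρ.relatorSpan_mem_of_length_lt hκ hq hχ (x := (u ++ i :: j :: k :: w, g))
    (u := u) (w := w) g (by simp; omega) hs
  have hjac := ρ.quantum_jacobi (v := v) (q := q) (κ := κ) i j k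
  rw [← neg_eq_iff_eq_neg] at hjac
  rw [← hjac] at hs'
  have mem : ∀ (u' : List (Fin n)) (a b : Fin n) (w' : List (Fin n)),
      wordOrder (u' ++ a :: b :: w', g) (u ++ i :: j :: k :: w, g) →
      wordOrder (u' ++ b :: a :: w', g) (u ++ i :: j :: k :: w, g) →
      ρ.wordProd v u' * ρ.relator v q κ a b * ρ.wordProd v w' * ρ.grp g ∈
        lowerRelations (R := K) wordOrder (ρ.DescentRelation v q κ) (u ++ i :: j :: k :: w, g) :=
    fun u' a b w' h h' => ρ.relator_mem_lowerRelations hκ hq g h h'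
  have ord : ∀ a b c : Fin n, List.Lex (· < ·) [a, b, c] [i, j, k] →
      wordOrder (u ++ a :: b :: c :: w, g) (u ++ i :: j :: k :: w, g) := by
    intro a b c h
    simpa using wordOrder_lex u w g g (s := [a, b, c]) (t := [i, j, k]) rfl h
  have m1 := mem (u ++ [k]) i j w (by simpa using ord k i j (.rel hki))
    (by simpa using ord k j i (.rel hki))
  have m2 := mem u j k (i :: w) (ord j k i (.rel hji)) (ord k j i (.rel hki))
  have m3 := mem u k i (j :: w) (ord k i j (.rel hki)) (ord i k j (.cons (.rel hkj)))
  have m4 := mem (u ++ [j]) k i w (by simpa using ord j k i (.rel hji))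
    (by simpa using ord j i k (.rel hji))
  -- The two sides of the overlap occur in the Jacobi sum with coefficients q_ki and -q_ki; its
  -- other four terms are `m1` to `m4`, on smaller words.
  rw [← Submodule.smul_mem_iff _ (hq.ne_zero k i)]
  convert add_mem (add_mem (neg_mem hs') (Submodule.smul_mem _ (q j k) m1)) (add_mem
    (Submodule.smul_mem _ (-q i j) m2) (add_mem (Submodule.smul_mem _ (-q j k) m3)
    (Submodule.smul_mem _ (q i j) m4))) using 1
  simp only [wordProd_append, wordProd_cons, wordProd_nil, mul_one, mul_add, add_mul, mul_sub,
    sub_mul, mul_neg, neg_mul, smul_mul_assoc, mul_smul_comm, mul_assoc]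
  module

-- Two descents of one word coincide, share one letter, or are disjoint, according to the length of
-- `s`.
include hκ hq hχ hinv hc hJ in
theorem descentRelation_resolvable (x : List (Fin n) × G) (e e' : A)
    (h : ρ.DescentRelation v q κ x e) (h' : ρ.DescentRelation v q κ x e') :
    e - e' ∈ lowerRelations (R := K) wordOrder (ρ.DescentRelation v q κ) x := by
  have key : ∀ (u : List (Fin n)) (a b : Fin n) (w s : List (Fin n)) (c d : Fin n)
      (w' : List (Fin n)) (g : G), b < a → d < c → a :: b :: w = s ++ c :: d :: w' →
      ρ.wordProd v u * ρ.relator v q κ a b * ρ.wordProd v w * ρ.grp g -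
        ρ.wordProd v (u ++ s) * ρ.relator v q κ c d * ρ.wordProd v w' * ρ.grp g ∈
        lowerRelations (R := K) wordOrder (ρ.DescentRelation v q κ) (u ++ a :: b :: w, g) := by
    intro u a b w s c d w' g hab hcd heq
    match s with
    | [] =>
      simp only [List.nil_append, List.cons.injEq] at heq
      obtain ⟨rfl, rfl, rfl⟩ := heq
      simp
    | [y] =>
      simp only [List.cons_append, List.nil_append, List.cons.injEq] at heq
      obtain ⟨rfl, rfl, rfl⟩ := heq
      exact ρ.overlap_resolvable hκ hq hχ hc hJ u hab hcd w' g
    | y :: z :: s =>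
      simp only [List.cons_append, List.cons.injEq] at heq
      obtain ⟨rfl, rfl, rfl⟩ := heq
      exact ρ.disjoint_resolvable hκ hq hχ hinv u hab s hcd w' g
  obtain ⟨u, a, b, w, g, hab⟩ := h
  generalize hx : (u ++ a :: b :: w, g) = x at h'
  obtain ⟨u', c, d, w', g', hcd⟩ := h'
  obtain ⟨hw, rfl⟩ := Prod.mk.inj hx
  rcases List.append_eq_append_iff.1 hw with ⟨s, rfl, hs⟩ | ⟨s, rfl, hs⟩
  · rw [← hw]
    exact key u a b w s c d w' g hab hcd hs
  · rw [← neg_mem_iff, neg_sub]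
    exact key u' c d w' s a b w g hcd hab hs

end CovariantPair

end

/-! ### The ideal of relations and sufficiency of the conditions -/

noncomputable section

set_option linter.unusedSectionVars false

open LinearRewriting

variable {K G V : Type*} [Field K] [CommGroup G] [AddCommGroup V] [Module K V]
  [DistribMulAction G V] [SMulCommClass G K V] {n : ℕ} {v : Module.Basis (Fin n) K V}
  {q : Fin n → Fin n → K} {κ : V →ₗ[K] V →ₗ[K] V ⊗[K] MonoidAlgebra K G}
  {χ : Fin n → G →* Kˣ}

namespace CovariantPair

variable {A : Type*} [Ring A] [Algebra K A] (ρ : CovariantPair K G V A)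
  (hχ : ∀ (g : G) (i : Fin n), g • v i = (χ i g : K) • v i)
  {b : Module.Basis (List (Fin n) × G) K A} (hb : ∀ x, b x = ρ.wordProd v x.1 * ρ.grp x.2)
  [CharZero K] (hκ : IsQuantumAntisymm v q κ) (hq : IsQuantumSystem q) (hinv : IsInvariant κ)

include hχ hb hκ hq in
theorem relations_mul_mem {y : A} (hy : y ∈ relations (R := K) (ρ.DescentRelation v q κ)) (z : A) :
    y * z ∈ relations (R := K) (ρ.DescentRelation v q κ) := by
  have h1 : ∀ x, y * b x ∈ relations (R := K) (ρ.DescentRelation v q κ) := by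
    intro x
    have h2 : relations (R := K) (ρ.DescentRelation v q κ) ≤
        (relations (R := K) (ρ.DescentRelation v q κ)).comap (LinearMap.mulRight K (b x)) := by
      refine Submodule.span_le.2 ?_
      rintro _ ⟨_, ⟨u, a, c, w, g, hca⟩⟩
      have h3 : ρ.wordProd v u * ρ.relator v q κ a c * ρ.wordProd v w * ρ.grp g * b x =
          (wordChar χ x.1 g : K) • (ρ.wordProd v u * ρ.relator v q κ a c *
            ρ.wordProd v (w ++ x.1) * ρ.grp (g * x.2)) := by
        rw [hb, mul_assoc _ (ρ.grp g), ← mul_assoc (ρ.grp g), ρ.grp_mul_wordProd_mul_grp hχ]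
        simp only [mul_smul_comm, wordProd_append, mul_assoc]
      simp only [SetLike.mem_coe, Submodule.mem_comap, LinearMap.mulRight_apply]
      rw [h3]
      exact Submodule.smul_mem _ _ (ρ.relator_mem_relations hκ hq _ _ _ _ _)
    exact h2 hy
  have h4 : (⊤ : Submodule K A) ≤
      (relations (R := K) (ρ.DescentRelation v q κ)).comap (LinearMap.mulLeft K y) := by
    rw [← b.span_eq]
    refine Submodule.span_le.2 ?_
    rintro _ ⟨x, rfl⟩
    exact h1 x
  exact h4 (Submodule.mem_top (x := z))

-- Unlike right multiplication, left multiplication drags group elements across the relator, which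
-- requires invariance.
include hχ hb hκ hq hinv in
theorem mul_relations_mem (z : A) {y : A} (hy : y ∈ relations (R := K) (ρ.DescentRelation v q κ)) :
    z * y ∈ relations (R := K) (ρ.DescentRelation v q κ) := by
  have h1 : ∀ x, b x * y ∈ relations (R := K) (ρ.DescentRelation v q κ) := by
    intro x
    have h2 : relations (R := K) (ρ.DescentRelation v q κ) ≤
        (relations (R := K) (ρ.DescentRelation v q κ)).comap (LinearMap.mulLeft K (b x)) := by
      refine Submodule.span_le.2 ?_
      rintro _ ⟨_, ⟨u, a, c, w, g, hca⟩⟩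
      have h3 : b x * (ρ.wordProd v u * ρ.relator v q κ a c * ρ.wordProd v w * ρ.grp g) =
          ((wordChar χ u x.2 : K) * (χ a x.2 * χ c x.2) * wordChar χ w x.2) •
            (ρ.wordProd v (x.1 ++ u) * ρ.relator v q κ a c *
            ρ.wordProd v w * ρ.grp (x.2 * g)) := by
        rw [hb, mul_assoc (ρ.wordProd v x.1), ρ.grp_mul_relator_context hχ hinv]
        simp only [mul_smul_comm, wordProd_append, mul_assoc]
      simp only [SetLike.mem_coe, Submodule.mem_comap, LinearMap.mulLeft_apply]
      rw [h3]
      exact Submodule.smul_mem _ _ (ρ.relator_mem_relations hκ hq _ _ _ _ _)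
    exact h2 hy
  have h4 : (⊤ : Submodule K A) ≤
      (relations (R := K) (ρ.DescentRelation v q κ)).comap (LinearMap.mulRight K y) := by
    rw [← b.span_eq]
    refine Submodule.span_le.2 ?_
    rintro _ ⟨x, rfl⟩
    exact h1 x
  exact h4 (Submodule.mem_top (x := z))

include hχ hb hκ hq hinv in
/-- The span of the relations attached to descents is a two-sided ideal containing the relators. -/
theorem exists_twoSidedIdeal :
    ∃ I : TwoSidedIdeal A, (∀ z, z ∈ I ↔ z ∈ relations (R := K) (ρ.DescentRelation v q κ)) ∧
      ∀ i j, ρ.relator v q κ i j ∈ I := by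
  refine ⟨.mk' (relations (R := K) (ρ.DescentRelation v q κ)) (zero_mem _) add_mem neg_mem
    (fun {x _} hy => ρ.mul_relations_mem hχ hb hκ hq hinv x hy)
    (fun {_ y} hx => ρ.relations_mul_mem hχ hb hκ hq hx y), fun z => ?_, fun i j => ?_⟩
  · rw [TwoSidedIdeal.mem_mk']; rfl
  · rw [TwoSidedIdeal.mem_mk']
    simpa using ρ.relator_mem_relations hκ hq [] [] i j 1

end CovariantPair

section Quotient

variable (v q κ) in
/-- The covariant pair of the maps into `H_{q,κ}`. -/
def quotientPair : CovariantPair K G V (QuotientAlgebra v q κ) where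
  vec := (RingQuot.mkAlgHom K (Rel v q κ)).toLinearMap.comp (skewPair K G V).vec
  grp := (RingQuot.mkAlgHom K (Rel v q κ) : SkewGroupAlgebra K G V →* _).comp (skewPair K G V).grp
  grp_mul_vec g x := by
    have := congrArg (RingQuot.mkAlgHom K (Rel v q κ)) ((skewPair K G V).grp_mul_vec g x)
    rwa [map_mul, map_mul] at this

theorem quotientPair_wordProd (w : List (Fin n)) :
    (quotientPair v q κ).wordProd v w =
      RingQuot.mkAlgHom K (Rel v q κ) ((skewPair K G V).wordProd v w) := by
  induction w with
  | nil => simp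
  | cons i w ih =>
    rw [CovariantPair.wordProd_cons, CovariantPair.wordProd_cons, map_mul, ih]
    rfl

theorem quotientPair_vecGrp (y : V ⊗[K] MonoidAlgebra K G) :
    (quotientPair v q κ).vecGrp y =
      RingQuot.mkAlgHom K (Rel v q κ) ((skewPair K G V).vecGrp y) := by
  induction y using tmul_single_induction with
  | h0 => simp
  | hadd y z hy hz => simp only [map_add, hy, hz]
  | hs x g =>
    rw [CovariantPair.vecGrp_tmul_single, CovariantPair.vecGrp_tmul_single, map_mul]
    rfl

theorem mkAlgHom_relator (i j : Fin n) :
    RingQuot.mkAlgHom K (Rel v q κ) ((skewPair K G V).relator v q κ i j) = 0 := by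
  rw [← map_zero (RingQuot.mkAlgHom K (Rel v q κ))]
  exact RingQuot.mkAlgHom_rel K (Rel.commutator i j)

theorem quotientPair_relator (i j : Fin n) :
    (quotientPair v q κ).relator v q κ i j = 0 := by
  rw [← mkAlgHom_relator (v := v) (q := q) (κ := κ) i j, CovariantPair.relator,
    CovariantPair.relator, map_sub, map_sub, map_smul, map_mul, map_mul, quotientPair_vecGrp]
  rfl

theorem pbwMonomial_eq (p : (Fin n → ℕ) × G) :
    pbwMonomial v q κ p = (quotientPair v q κ).wordProd v (sortedWord p.1) *
      (quotientPair v q κ).grp p.2 := by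
  rw [pbwMonomial, monomial_eq_wordBasis, wordBasis_apply, map_mul, quotientPair_wordProd]
  rfl

theorem mem_of_mkAlgHom_eq_zero (I : TwoSidedIdeal (SkewGroupAlgebra K G V))
    (hI : ∀ i j, (skewPair K G V).relator v q κ i j ∈ I) {z : SkewGroupAlgebra K G V}
    (hz : RingQuot.mkAlgHom K (Rel v q κ) z = 0) : z ∈ I := by
  have h : ∀ ⦃x y⦄, Rel v q κ x y → I.ringCon.mk' x = I.ringCon.mk' y := by
    rintro _ _ ⟨i, j⟩
    exact (RingCon.eq _).2 (hI i j)
  have h1 : RingQuot.mkRingHom (Rel v q κ) z = 0 := by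
    rw [← RingQuot.mkAlgHom_coe K]; exact hz
  have h2 := RingQuot.lift_mkRingHom_apply I.ringCon.mk' h z
  rw [h1, map_zero] at h2
  exact (TwoSidedIdeal.mem_iff _ _).2 ((RingCon.eq _).1 h2.symm)

theorem descentRelation_irreducible {x : List (Fin n) × G} :
    (∀ e, ¬ (skewPair K G V).DescentRelation v q κ x e) ↔ x.1.Pairwise (· ≤ ·) := by
  constructor
  · intro h
    rcases pairwise_or_exists_descent x.1 with h1 | ⟨u, a, b, w, hab, hx⟩
    · exact h1
    · obtain ⟨w', g⟩ := x
      obtain rfl : w' = _ := hx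
      exact absurd (.mk u a b w g hab) (h _)
  · rintro h _ ⟨u, a, b, w, g, hab⟩
    exact not_pairwise_of_descent hab h

theorem span_monomial :
    Submodule.span K (Set.range (monomial (G := G) v)) =
      normalSpan (wordBasis K G v) ((skewPair K G V).DescentRelation v q κ) := by
  rw [normalSpan]
  congr 1
  ext z
  constructor
  · rintro ⟨p, rfl⟩
    exact ⟨(sortedWord p.1, p.2), descentRelation_irreducible.2 (pairwise_sortedWord _),
      (monomial_eq_wordBasis v p).symm⟩
  · rintro ⟨x, hx, rfl⟩
    refine ⟨(fun i => x.1.count i, x.2), ?_⟩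
    rw [monomial_eq_wordBasis, ← eq_sortedWord (descentRelation_irreducible.1 hx)]

theorem linearIndependent_monomial : LinearIndependent K (monomial (G := G) v) := by
  have h : monomial (G := G) v =
      wordBasis K G v ∘ fun p : (Fin n → ℕ) × G => (sortedWord p.1, p.2) :=
    funext (monomial_eq_wordBasis v)
  rw [h]
  refine (wordBasis K G v).linearIndependent.comp _ fun p p' hp => ?_
  exact Prod.ext (sortedWord_injective (Prod.mk.inj hp).1) (Prod.mk.inj hp).2

/-- Rewriting terminates whatever κ is, so none of the three conditions is needed. -/
theorem span_pbwMonomial (hχ : ∀ (g : G) (i : Fin n), g • v i = (χ i g : K) • v i) :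
    Submodule.span K (Set.range (pbwMonomial v q κ)) = ⊤ := by
  have h := relations_sup_normalSpan (b := wordBasis K G v) wordOrder_wf fun x e he =>
    (skewPair K G V).sub_mem_lowerSpan (v := v) (q := q) (κ := κ) hχ (wordBasis_apply v) he
  have h1 : (relations (R := K) ((skewPair K G V).DescentRelation v q κ)).map
      (RingQuot.mkAlgHom K (Rel v q κ)).toLinearMap = ⊥ := by
    rw [← le_bot_iff, Submodule.map_le_iff_le_comap]
    refine Submodule.span_le.2 ?_
    rintro _ ⟨_, ⟨u, a, b, w, g, hab⟩⟩
    simp [mkAlgHom_relator]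
  have h2 := congrArg (Submodule.map (RingQuot.mkAlgHom K (Rel v q κ)).toLinearMap) h
  rw [Submodule.map_sup, h1, bot_sup_eq, ← span_monomial, Submodule.map_span, ← Set.range_comp,
    Submodule.map_top, LinearMap.range_eq_top.2 (RingQuot.mkAlgHom_surjective K _)] at h2
  exact h2

theorem hasPBW_of_conditions [CharZero K] (hκ : IsQuantumAntisymm v q κ) (hq : IsQuantumSystem q)
    (hχ : ∀ (g : G) (i : Fin n), g • v i = (χ i g : K) • v i) (hinv : IsInvariant κ)
    (hc : IsCompatible v q κ χ)
    (hJ : ∀ i j k : Fin n, i ≠ j → j ≠ k → i ≠ k →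
      0 = jacobiSummand v χ q κ i j k + jacobiSummand v χ q κ j k i +
        jacobiSummand v χ q κ k i j) :
    HasPBW v q κ := by
  refine ⟨?_, span_pbwMonomial hχ⟩
  obtain ⟨I, hI, hrel⟩ := (skewPair K G V).exists_twoSidedIdeal (v := v) (q := q) (κ := κ) hχ
    (wordBasis_apply v) hκ hq hinv
  have hd := disjoint_normalSpan_relations (b := wordBasis K G v) wordOrder_wf
    (fun x e he => (skewPair K G V).sub_mem_lowerSpan (v := v) (q := q) (κ := κ) hχ
      (wordBasis_apply v) he)
    (fun x e e' => (skewPair K G V).descentRelation_resolvable hκ hq hχ hinv hc hJ x e e')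
  refine linearIndependent_monomial.map_injOn (RingQuot.mkAlgHom K (Rel v q κ)).toLinearMap ?_
  rw [span_monomial (q := q) (κ := κ)]
  intro x hx y hy hxy
  have hz : RingQuot.mkAlgHom K (Rel v q κ) (x - y) = 0 := by
    rw [map_sub]
    exact sub_eq_zero.2 hxy
  exact sub_eq_zero.1 ((Submodule.disjoint_def.1 hd) _ (sub_mem hx hy)
    ((hI _).1 (mem_of_mkAlgHom_eq_zero I hrel hz)))

end Quotient

end

/-! ### Necessity of the conditions -/

noncomputable section

set_option linter.unusedSectionVars false

variable {K G V : Type*} [Field K] [CommGroup G] [AddCommGroup V] [Module K V]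
  [DistribMulAction G V] [SMulCommClass G K V] {n : ℕ} {v : Module.Basis (Fin n) K V}
  {q : Fin n → Fin n → K} {κ : V →ₗ[K] V →ₗ[K] V ⊗[K] MonoidAlgebra K G}
  {χ : Fin n → G →* Kˣ}

theorem count_pair_eq_iff {a b r s : Fin n} :
    ((fun i => [a, b].count i) = fun i => [r, s].count i) ↔
      (a = r ∧ b = s) ∨ (a = s ∧ b = r) := by
  constructor
  · intro h
    have h1 : [a, b].Perm [r, s] := List.perm_iff_count.2 fun i => congrFun h i
    have h2 : a ∈ [r, s] := h1.subset (by simp)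
    simp only [List.mem_cons, List.not_mem_nil, or_false] at h2
    rcases h2 with rfl | rfl
    · left
      simpa using h1
    · right
      have h3 := h1.trans (List.Perm.swap a r [])
      simpa using h3
  · rintro (⟨rfl, rfl⟩ | ⟨rfl, rfl⟩)
    · rfl
    · funext i
      exact (List.Perm.swap b a []).count_eq i

theorem count_singleton_ne_pair (a r s : Fin n) :
    (fun i => [a].count i) ≠ fun i => [r, s].count i := by
  intro h
  have h1 : [a].Perm [r, s] := List.perm_iff_count.2 fun i => congrFun h i
  simpa using h1.length_eq

theorem count_singleton_inj {a r : Fin n} :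
    ((fun i => [a].count i) = fun i => [r].count i) ↔ a = r := by
  constructor
  · intro h
    have h1 : [a].Perm [r] := List.perm_iff_count.2 fun i => congrFun h i
    simpa using h1
  · rintro rfl; rfl

namespace CovariantPair

variable {A : Type*} [Ring A] [Algebra K A] (ρ : CovariantPair K G V A)
  {b : Module.Basis ((Fin n → ℕ) × G) K A}
  (hb : ∀ p, b p = ρ.wordProd v (sortedWord p.1) * ρ.grp p.2)

include hb in
theorem wordProd_mul_grp_of_sorted {w : List (Fin n)} (hw : w.Pairwise (· ≤ ·)) (g : G) :
    ρ.wordProd v w * ρ.grp g = b (fun i => w.count i, g) := by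
  rw [hb, ← eq_sortedWord hw]

include hb in
theorem vec_mul_grp_eq (r : Fin n) (g : G) :
    ρ.vec (v r) * ρ.grp g = b (fun i => [r].count i, g) := by
  simpa using ρ.wordProd_mul_grp_of_sorted hb (w := [r]) (by simp) g

include hb in
theorem repr_vecGrp (y : V ⊗[K] MonoidAlgebra K G) (r : Fin n) (g : G) :
    b.repr (ρ.vecGrp y) (fun i => [r].count i, g) = v.repr (components K G V y g) r := by
  classical
  induction y using tmul_single_induction with
  | h0 => simp
  | hadd y z hy hz => simp only [map_add, Finsupp.add_apply, hy, hz]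
  | hs x h =>
    rw [vecGrp_tmul_single, components_tmul_single, ρ.vec_eq_sum (v := v), Finset.sum_mul]
    simp only [smul_mul_assoc, ρ.vec_mul_grp_eq hb, map_sum, map_smul, Module.Basis.repr_self,
      Finsupp.finsetSum_apply, Finsupp.smul_apply, Finsupp.single_apply, Prod.mk.injEq,
      count_singleton_inj, smul_eq_mul]
    by_cases hg : h = g
    · simp [hg]
    · simp [hg]

include hb in
theorem vecGrp_injective : Function.Injective ρ.vecGrp := by
  rw [injective_iff_map_eq_zero]
  intro y hy
  have h : components K G V y = 0 := by
    ext g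
    refine v.repr.injective (Finsupp.ext fun r => ?_)
    rw [← ρ.repr_vecGrp hb, hy]
    simp
  simpa using h

include hb in
theorem coord_pair_vecGrp (y : V ⊗[K] MonoidAlgebra K G) (r s : Fin n) (g : G) :
    b.coord (fun i => [r, s].count i, g) (ρ.vecGrp y) = 0 := by
  classical
  have h := ρ.vecGrp_mem_of_forall (v := v) (x := 1) (z := 1)
    (N := LinearMap.ker (b.coord (fun i => [r, s].count i, g))) (fun a h => ?_) y
  · simpa using h
  · rw [LinearMap.mem_ker, one_mul, mul_one, ρ.vec_mul_grp_eq hb, Module.Basis.coord_apply,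
      Module.Basis.repr_self, Finsupp.single_apply, if_neg]
    exact fun h => count_singleton_ne_pair a r s (Prod.mk.inj h).1

variable (hrel : ∀ i j, ρ.relator v q κ i j = 0)

-- The κ term is linear, so quadratic coordinates behave as in the quantum polynomial ring. With
-- this, indices need not be sorted in later arguments.
include hb hrel in
theorem coord_pair_swap (r s x y : Fin n) (g h : G) :
    b.coord (fun i => [r, s].count i, g) (ρ.vec (v x) * ρ.vec (v y) * ρ.grp h) =
      q x y * b.coord (fun i => [r, s].count i, g) (ρ.vec (v y) * ρ.vec (v x) * ρ.grp h) := by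
  rw [ρ.vec_mul_vec (q := q) (κ := κ) x y, hrel, zero_add, add_mul, map_add, ← ρ.vecGrp_mulGrp,
    ρ.coord_pair_vecGrp hb, add_zero, smul_mul_assoc, map_smul, smul_eq_mul]

include hb in
theorem vec_mul_vec_mul_grp_eq {x y : Fin n} (hxy : x ≤ y) (h : G) :
    ρ.vec (v x) * ρ.vec (v y) * ρ.grp h = b (fun i => [x, y].count i, h) := by
  simpa using ρ.wordProd_mul_grp_of_sorted hb (w := [x, y]) (by simpa using hxy) h

include hb hrel in
theorem coord_pair_eq_zero {r s x y : Fin n} {g h : G}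
    (hne : ¬ (((x = r ∧ y = s) ∨ (x = s ∧ y = r)) ∧ h = g)) :
    b.coord (fun i => [r, s].count i, g) (ρ.vec (v x) * ρ.vec (v y) * ρ.grp h) = 0 := by
  classical
  have key : ∀ x y, ¬ (((x = r ∧ y = s) ∨ (x = s ∧ y = r)) ∧ h = g) → x ≤ y →
      b.coord (fun i => [r, s].count i, g) (ρ.vec (v x) * ρ.vec (v y) * ρ.grp h) = 0 := by
    intro x y hne hxy
    rw [ρ.vec_mul_vec_mul_grp_eq hb hxy, Module.Basis.coord_apply, Module.Basis.repr_self,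
      Finsupp.single_apply, if_neg]
    intro h'
    exact hne ⟨count_pair_eq_iff.1 (Prod.mk.inj h').1, (Prod.mk.inj h').2⟩
  rcases le_total x y with hxy | hxy
  · exact key x y hne hxy
  · rw [ρ.coord_pair_swap hb hrel, key y x (by tauto) hxy, mul_zero]

include hb hrel in
theorem coord_pair_ne_zero (hq : IsQuantumSystem q) (r s : Fin n) (g : G) :
    b.coord (fun i => [r, s].count i, g) (ρ.vec (v r) * ρ.vec (v s) * ρ.grp g) ≠ 0 := by
  rcases le_total r s with hrs | hrs
  · rw [ρ.vec_mul_vec_mul_grp_eq hb hrs, Module.Basis.coord_apply, Module.Basis.repr_self]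
    simp
  · rw [ρ.coord_pair_swap hb hrel, ρ.vec_mul_vec_mul_grp_eq hb hrs,
      (count_pair_eq_iff (a := r) (b := s) (r := s) (s := r)).2 (by simp),
      Module.Basis.coord_apply, Module.Basis.repr_self]
    simpa using hq.ne_zero r s

variable (hχ : ∀ (g : G) (i : Fin n), g • v i = (χ i g : K) • v i)

include hb hrel hχ in
theorem coord_pair_jacobi_term (i j k r s : Fin n) (g : G) :
    b.coord (fun i => [r, s].count i, g)
      (q k i • (ρ.vecGrp (κ (v i) (v j)) * ρ.vec (v k)) -
        q j k • (ρ.vec (v k) * ρ.vecGrp (κ (v i) (v j)))) =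
    ∑ x, coef v κ x i j g * (q k i * χ k g - q j k * q k x) *
      b.coord (fun i => [r, s].count i, g) (ρ.vec (v x) * ρ.vec (v k) * ρ.grp g) := by
  classical
  -- Inserting g ensures that it indexes a term even when κ_g(v_i, v_j) = 0.
  rw [ρ.jacobi_term_eq_sum hχ (S := insert g (components K G V (κ (v i) (v j))).support) k
    (Finset.subset_insert _ _), map_sum, Finset.sum_eq_single g]
  · rw [map_sum]
    refine Finset.sum_congr rfl fun x _ => ?_
    rw [smul_mul_assoc, map_smul, sub_mul, map_sub, smul_mul_assoc, smul_mul_assoc, map_smul,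
      map_smul, ρ.coord_pair_swap hb hrel r s k x]
    simp only [smul_eq_mul]
    ring
  · intro h _ hne
    rw [map_sum]
    refine Finset.sum_eq_zero fun x _ => ?_
    rw [smul_mul_assoc, map_smul, sub_mul, map_sub, smul_mul_assoc, smul_mul_assoc, map_smul,
      map_smul, ρ.coord_pair_eq_zero hb hrel (by tauto), ρ.coord_pair_eq_zero hb hrel (by tauto)]
    simp
  · simp

-- Every quadratic monomial arising from this term contains v_k.
include hb hrel hχ in
theorem coord_pair_jacobi_term_eq_zero (i j : Fin n) {k r s : Fin n} (g : G) (hr : k ≠ r)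
    (hs : k ≠ s) :
    b.coord (fun i => [r, s].count i, g)
      (q k i • (ρ.vecGrp (κ (v i) (v j)) * ρ.vec (v k)) -
        q j k • (ρ.vec (v k) * ρ.vecGrp (κ (v i) (v j)))) = 0 := by
  rw [ρ.coord_pair_jacobi_term hb hrel hχ]
  refine Finset.sum_eq_zero fun x _ => ?_
  rw [ρ.coord_pair_eq_zero hb hrel (by tauto), mul_zero]

include hb hrel hχ in
theorem coord_pair_jacobi_term_self (i j k r : Fin n) (g : G) :
    b.coord (fun i => [r, k].count i, g)
      (q k i • (ρ.vecGrp (κ (v i) (v j)) * ρ.vec (v k)) -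
        q j k • (ρ.vec (v k) * ρ.vecGrp (κ (v i) (v j)))) =
    coef v κ r i j g * (q k i * χ k g - q j k * q k r) *
      b.coord (fun i => [r, k].count i, g) (ρ.vec (v r) * ρ.vec (v k) * ρ.grp g) := by
  rw [ρ.coord_pair_jacobi_term hb hrel hχ, Finset.sum_eq_single r]
  · intro x _ hx
    rw [ρ.coord_pair_eq_zero hb hrel, mul_zero]
    rintro ⟨⟨h, -⟩ | ⟨h, h'⟩, -⟩
    · exact hx h
    · exact hx (h.trans h')
  · simp

include hrel in
theorem jacobi_sum_eq_zero (i j k : Fin n) :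
    (q k i • (ρ.vecGrp (κ (v i) (v j)) * ρ.vec (v k)) -
        q j k • (ρ.vec (v k) * ρ.vecGrp (κ (v i) (v j))))
    + (q i j • (ρ.vecGrp (κ (v j) (v k)) * ρ.vec (v i)) -
        q k i • (ρ.vec (v i) * ρ.vecGrp (κ (v j) (v k))))
    + (q j k • (ρ.vecGrp (κ (v k) (v i)) * ρ.vec (v j)) -
        q i j • (ρ.vec (v j) * ρ.vecGrp (κ (v k) (v i)))) = 0 := by
  have h := ρ.quantum_jacobi (v := v) (q := q) (κ := κ) i j k
  simp only [hrel, zero_mul, mul_zero, smul_zero, sub_zero, add_zero] at h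
  exact neg_eq_zero.1 h.symm

-- For r ≠ i, j the v_r v_k g coordinate of the Jacobi sum sees only the term with outer factor v_k,
-- which gives the first equation after division by a nonzero coordinate.
include hb hrel hχ in
theorem isCompatible (hq : IsQuantumSystem q) : IsCompatible v q κ χ := by
  intro g i j k hij hjk hik
  have e2 : q k i * q i k = 1 := by rw [hq.symm k i, mul_inv_cancel₀ (hq.ne_zero k i)]
  constructor
  · intro r hri hrj
    have h := congrArg (b.coord (fun i => [r, k].count i, g)) (ρ.jacobi_sum_eq_zero hrel i j k)
    rw [map_add, map_add, ρ.coord_pair_jacobi_term_self hb hrel hχ,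
      ρ.coord_pair_jacobi_term_eq_zero hb hrel hχ _ _ _ hri.symm hik,
      ρ.coord_pair_jacobi_term_eq_zero hb hrel hχ _ _ _ hrj.symm hjk, map_zero, add_zero,
      add_zero] at h
    have h1 := (mul_eq_zero.1 h).resolve_right (ρ.coord_pair_ne_zero hb hrel hq r k g)
    linear_combination -q i k * h1 + (χ k g : K) * coef v κ r i j g * e2
  -- At v_i v_k g the terms with outer factors v_k and v_i both contribute, while the one with v_j
  -- does not; this yields the second equation.
  · have h := congrArg (b.coord (fun x => [i, k].count x, g)) (ρ.jacobi_sum_eq_zero hrel i j k)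
    have hswap := (count_pair_eq_iff (a := i) (b := k) (r := k) (s := i)).2 (by simp)
    rw [map_add, map_add, ρ.coord_pair_jacobi_term_self hb hrel hχ,
      ρ.coord_pair_jacobi_term_eq_zero hb hrel hχ k i g hij.symm hjk, hswap,
      ρ.coord_pair_jacobi_term_self hb hrel hχ, map_zero, add_zero, ← hswap,
      ρ.coord_pair_swap hb hrel i k k i] at h
    have h0 := ρ.coord_pair_ne_zero hb hrel hq i k g
    generalize b.coord (fun x => [i, k].count x, g) (ρ.vec (v i) * ρ.vec (v k) * ρ.grp g) = Q
      at h h0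
    have h1 : (coef v κ i i j g * (q k i * χ k g - q j k * q k i) +
      coef v κ k j k g * (q i j * χ i g - q k i * q i k) * q k i) = 0 := by
      refine (mul_eq_zero.1 ?_).resolve_right h0
      linear_combination h
    refine mul_left_cancel₀ (hq.ne_zero k i) ?_
    linear_combination h1 + coef v κ k j k g * q k i * e2

-- With all relators zero, `jacobi_sum_mem` becomes an equality, which pulls back along the
-- injection of V ⊗ KG.
include hb hrel hχ in
theorem jacobi_eq_zero (hq : IsQuantumSystem q) {i j k : Fin n} (hij : i ≠ j) (hjk : j ≠ k)
    (hik : i ≠ k) :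
    0 = jacobiSummand v χ q κ i j k + jacobiSummand v χ q κ j k i +
      jacobiSummand v χ q κ k i j := by
  have h := ρ.jacobi_sum_mem hχ hq (ρ.isCompatible hb hrel hχ hq) hij hjk hik
  have h0 : ρ.relatorSpan v q κ = ⊥ := by
    rw [← le_bot_iff, relatorSpan, Submodule.span_le]
    rintro _ ⟨x, y, g, rfl⟩
    simp [hrel]
  rw [h0, Submodule.mem_bot, ρ.jacobi_sum_eq_zero hrel, zero_add, ← map_zero ρ.vecGrp] at h
  exact (ρ.vecGrp_injective hb h).symm

-- Moving g past v_i v_j before or after applying the relation gives equal q-commuted terms, so the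
-- κ terms agree; g is then cancelled on the right.
include hb hrel hχ in
theorem isInvariant : IsInvariant κ := by
  have key : ∀ g i j, κ (g • v i) (g • v j) = adjointAction g (κ (v i) (v j)) := by
    intro g i j
    have h2 : ∀ x y, ρ.grp g * (ρ.vec (v x) * ρ.vec (v y)) =
        ((χ x g : K) * χ y g) • (ρ.vec (v x) * ρ.vec (v y) * ρ.grp g) := by
      intro x y
      rw [← mul_assoc, ρ.grp_mul_vec_basis hχ, smul_mul_assoc, mul_assoc,
        ρ.grp_mul_vec_basis hχ, mul_smul_comm, smul_smul, mul_assoc]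
    have h3 : ∀ x y, ρ.vec (v x) * ρ.vec (v y) = q x y • (ρ.vec (v y) * ρ.vec (v x)) +
        ρ.vecGrp (κ (v x) (v y)) := by
      intro x y
      rw [ρ.vec_mul_vec (q := q) (κ := κ), hrel, zero_add]
    have h4 := h2 i j
    rw [h3, mul_add, mul_smul_comm, h2, ρ.grp_mul_vecGrp, add_mul, smul_add, smul_mul_assoc,
      smul_comm (q i j), mul_comm (χ j g : K), add_right_inj] at h4
    have h5 := congrArg (· * ρ.grp g⁻¹) h4
    simp only [smul_mul_assoc, mul_assoc, ← map_mul, mul_inv_cancel, map_one, mul_one] at h5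
    rw [← map_smul] at h5
    rw [ρ.vecGrp_injective hb h5, hχ, hχ, map_smul, map_smul, LinearMap.smul_apply, smul_smul,
      mul_comm]
  intro g x y
  have h : κ.compl₁₂ (DistribSMul.toLinearMap K V g) (DistribSMul.toLinearMap K V g) =
      κ.compr₂ (adjointAction g) :=
    v.ext fun i => v.ext fun j => key g i j
  exact LinearMap.congr_fun (LinearMap.congr_fun h x) y

end CovariantPair

theorem conditions_of_hasPBW (hq : IsQuantumSystem q)
    (hχ : ∀ (g : G) (i : Fin n), g • v i = (χ i g : K) • v i) (h : HasPBW v q κ) :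
    IsInvariant κ ∧ IsCompatible v q κ χ ∧
      ∀ i j k : Fin n, i ≠ j → j ≠ k → i ≠ k →
        0 = jacobiSummand v χ q κ i j k + jacobiSummand v χ q κ j k i +
          jacobiSummand v χ q κ k i j := by
  obtain ⟨b, hb⟩ : ∃ b : Module.Basis ((Fin n → ℕ) × G) K (QuotientAlgebra v q κ),
      ∀ p, b p = (quotientPair v q κ).wordProd v (sortedWord p.1) *
        (quotientPair v q κ).grp p.2 :=
    ⟨Module.Basis.mk h.1 h.2.ge, fun p => by rw [Module.Basis.mk_apply, pbwMonomial_eq]⟩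
  exact ⟨(quotientPair v q κ).isInvariant hb quotientPair_relator hχ,
    (quotientPair v q κ).isCompatible hb quotientPair_relator hχ hq,
    fun i j k hij hjk hik =>
      (quotientPair v q κ).jacobi_eq_zero hb quotientPair_relator hχ hq hij hjk hik⟩

end

end QuantumDrinfeld

theorem theorem3p1 {K G V : Type*} [Field K] [CharZero K] [CommGroup G]
    [AddCommGroup V] [Module K V] [DistribMulAction G V] [SMulCommClass G K V]
    {n : ℕ} (v : Module.Basis (Fin n) K V)
    (χ : Fin n → G →* Kˣ) (hχ : ∀ (g : G) (i : Fin n), g • v i = (χ i g : K) • v i)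
    (q : Fin n → Fin n → K) (hq : QuantumDrinfeld.IsQuantumSystem q)
    (κ : V →ₗ[K] V →ₗ[K] V ⊗[K] MonoidAlgebra K G)
    (hκ : QuantumDrinfeld.IsQuantumAntisymm v q κ) :
    QuantumDrinfeld.HasPBW v q κ ↔
      QuantumDrinfeld.IsInvariant κ ∧
      (∀ (g : G) (i j k : Fin n), i ≠ j → j ≠ k → i ≠ k →
        (∀ r : Fin n, r ≠ i → r ≠ j →
          0 = ((χ k g : K) - q j k * q i k * q k r) * QuantumDrinfeld.coef v κ r i j g) ∧
        0 = (1 - q i j * (χ i g : K)) * QuantumDrinfeld.coef v κ k j k g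
          + (q j k - (χ k g : K)) * QuantumDrinfeld.coef v κ i i j g) ∧
      (∀ i j k : Fin n, i ≠ j → j ≠ k → i ≠ k →
        0 = QuantumDrinfeld.jacobiSummand v χ q κ i j k
          + QuantumDrinfeld.jacobiSummand v χ q κ j k i
          + QuantumDrinfeld.jacobiSummand v χ q κ k i j) := by
  constructor
  · exact QuantumDrinfeld.conditions_of_hasPBW hq hχ
  · rintro ⟨hinv, hc, hJ⟩
    exact QuantumDrinfeld.hasPBW_of_conditions hκ hq hχ hinv hc hJ
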